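/- Let $\mathsf{RCA}_0^\omega$ be Kohlenbach's base theory of higher-order reverse mathematics: classical many-sorted predicate logic over all finite types with equality of type $0$ as primitive, the axioms for $0,S,+,\times$, the combinators $\Pi,\Sigma$ and the recursor $R_0$, extensionality at all types, quantifier-free induction, and $\mathsf{QF\text{-}AC}^{1,0}$. Let $\mathsf{ACA}_0^\omega$ be $\mathsf{RCA}_0^\omega$ plus $$(\exists^2)\qquad (\exists \varphi^{2}\leq_2 1)(\forall f^{1})\big[(\exists n)(f(n)=0)\leftrightarrow \varphi(f)=0\big].$$ Real numbers are represented by fast-converging Cauchy sequences of rationals, with equality $=_{\mathbb R}$ defined as usual. For $\mathsf X$ one of $[0,1]$, $\mathbb R$ and Cantor space $C=2^{\mathbb N}$, functions on $\mathsf X$ respect equality on $\mathsf X$, and a set $A\subset \mathsf X$ is given by a function $A:\mathsf X\to\{0,1\}$, where $x\in A$ means $A(x)=1$. The set $A$ is countable if there is $Y:\mathsf X\to\mathbb N$ that is injective on $A$, and strongly countable if there is $Y:\mathsf X\to\mathbb N$ that is injective on $A$ and satisfies $(\forall n\in\mathbb N)(\exists x\in A)(Y(x)=n)$. It is enumerable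 if there is a sequence $(x_n)_{n\in\mathbb N}$ in $\mathsf X$ such that $(\forall x\in \mathsf X)\big(x\in A\leftrightarrow(\exists n\in\mathbb N)(x=_{\mathsf X} x_n)\big)$. Let $\mathsf{cocode}_0^{\mathsf X}$ be the statement that every non-empty countable subset of $\mathsf X$ is enumerable, let $\mathsf{cocode}_1^{\mathsf X}$ be the statement that every strongly countable subset of $\mathsf X$ is enumerable, and let $\mathsf{cocode}_i$ be $\mathsf{cocode}_i^{[0,1]}$. **Theorem.** For $i=0,1$, the theory $\mathsf{ACA}_0^\omega$ proves $$\mathsf{cocode}_i\leftrightarrow \mathsf{cocode}_i^{\mathbb R}\leftrightarrow \mathsf{cocode}_i^{C}.$$ -/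

import Mathlib

/-!
Classical many-sorted predicate logic over all finite types, the base theory `ACA₀^ω` of
higher-order reverse mathematics as a set of axioms, derivability from such a set, and the
enumeration principles `cocode₀`, `cocode₁` as sentences of that language.
-/

namespace HOA

/-- The finite types: `0` (natural numbers), and `σ → τ`. -/
inductive Ty : Type
  | nat : Ty
  | arr : Ty → Ty → Ty
  deriving DecidableEq

/-- Type `1 = 0 → 0`: number-theoretic functions. -/
abbrev Ty.one : Ty := Ty.arr Ty.nat Ty.nat

/-- Type `2 = 1 → 0`: functionals. -/
abbrev Ty.two : Ty := Ty.arr Ty.one Ty.nat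

/-- Type `0 → 1`: sequences of number-theoretic functions. -/
abbrev Ty.seq : Ty := Ty.arr Ty.nat Ty.one

/-- The constants: zero, successor, addition, multiplication, the combinators `Π` and `Σ` at all
types, and the recursor `R₀` of type `0`. -/
inductive Con : Ty → Type
  | zero : Con Ty.nat
  | succ : Con (Ty.arr Ty.nat Ty.nat)
  | add : Con (Ty.arr Ty.nat (Ty.arr Ty.nat Ty.nat))
  | mul : Con (Ty.arr Ty.nat (Ty.arr Ty.nat Ty.nat))
  | pi (ρ σ : Ty) : Con (Ty.arr ρ (Ty.arr σ ρ))
  | sigma (ρ σ τ : Ty) :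
      Con (Ty.arr (Ty.arr ρ (Ty.arr σ τ)) (Ty.arr (Ty.arr ρ σ) (Ty.arr ρ τ)))
  | recursor :
      Con (Ty.arr (Ty.arr Ty.nat (Ty.arr Ty.nat Ty.nat)) (Ty.arr Ty.nat (Ty.arr Ty.nat Ty.nat)))

/-- Terms. Every type `τ` has its own variables `var τ 0, var τ 1, …`; bound variables are
de Bruijn indices, counted separately for each type, so `Fm.all τ φ` binds `var τ 0` in `φ` and the
free variable `var τ n` of `Fm.all τ φ` is written `var τ (n + 1)` inside `φ`. -/
inductive Tm : Ty → Type
  | var (τ : Ty) (n : ℕ) : Tm τ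
  | con {τ : Ty} (c : Con τ) : Tm τ
  | app {σ τ : Ty} (s : Tm (Ty.arr σ τ)) (t : Tm σ) : Tm τ

/-- Formulas. The only prime formulas are equations of type `0` and falsum. -/
inductive Fm : Type
  | eq (s t : Tm Ty.nat) : Fm
  | bot : Fm
  | imp (φ ψ : Fm) : Fm
  | all (τ : Ty) (φ : Fm) : Fm

/-! ### Substitution -/

/-- A simultaneous substitution. -/
abbrev Sub : Type := (τ : Ty) → ℕ → Tm τ

/-- The identity substitution. -/
def Sub.id : Sub := fun τ n => Tm.var τ n

/-- Weakening: make room for a new variable `var τ 0`. -/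
def Sub.wk (τ : Ty) : Sub := fun ρ n => Tm.var ρ (if ρ = τ then n + 1 else n)

/-- `var τ 0 ↦ t`, `var τ (n + 1) ↦ s τ n`, and `s` on the variables of other types. -/
def Sub.cons (τ : Ty) (t : Tm τ) (s : Sub) : Sub := fun ρ n =>
  if h : ρ = τ then
    match n with
    | 0 => h ▸ t
    | k + 1 => s ρ k
  else s ρ n

def Tm.subst (s : Sub) : {τ : Ty} → Tm τ → Tm τ
  | _, Tm.var τ n => s τ n
  | _, Tm.con c => Tm.con c
  | _, Tm.app t u => Tm.app (t.subst s) (u.subst s)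

/-- `t` inside the scope of one more quantifier of type `τ`. -/
def Tm.wk (τ : Ty) {ρ : Ty} (t : Tm ρ) : Tm ρ := t.subst (Sub.wk τ)

/-- The substitution to be used below a quantifier of type `τ`. -/
def Sub.lift (τ : Ty) (s : Sub) : Sub := Sub.cons τ (Tm.var τ 0) (fun ρ n => (s ρ n).wk τ)

def Fm.subst : Sub → Fm → Fm
  | s, Fm.eq t u => Fm.eq (t.subst s) (u.subst s)
  | _, Fm.bot => Fm.bot
  | s, Fm.imp φ ψ => Fm.imp (φ.subst s) (ψ.subst s)
  | s, Fm.all τ φ => Fm.all τ (φ.subst (s.lift τ))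

def Fm.wk (τ : Ty) (φ : Fm) : Fm := φ.subst (Sub.wk τ)

/-- Replace `var τ 0` by `t` and remove it from the list of variables. -/
def Fm.inst {τ : Ty} (t : Tm τ) (φ : Fm) : Fm := φ.subst (Sub.cons τ t Sub.id)

/-! ### Defined connectives -/

def Fm.neg (φ : Fm) : Fm := Fm.imp φ Fm.bot
def Fm.or (φ ψ : Fm) : Fm := Fm.imp φ.neg ψ
def Fm.and (φ ψ : Fm) : Fm := (Fm.imp φ ψ.neg).neg
def Fm.iff (φ ψ : Fm) : Fm := (Fm.imp φ ψ).and (Fm.imp ψ φ)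
def Fm.ex (τ : Ty) (φ : Fm) : Fm := (Fm.all τ φ.neg).neg

/-- Quantifier-free formulas. -/
def Fm.QF : Fm → Prop
  | Fm.eq _ _ => True
  | Fm.bot => True
  | Fm.imp φ ψ => φ.QF ∧ ψ.QF
  | Fm.all _ _ => False

/-! ### Derivability -/

/-- Natural deduction for classical many-sorted predicate logic with equality of type `0`:
`Prf T Γ φ` says that `φ` is derivable from the axioms `T` (read universally closed) and the
assumptions `Γ`. -/
inductive Prf (T : Set Fm) : List Fm → Fm → Prop
  | ax {Γ : List Fm} {φ : Fm} : φ ∈ T → Prf T Γ φ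
  | hyp {Γ : List Fm} {φ : Fm} : φ ∈ Γ → Prf T Γ φ
  | impI {Γ : List Fm} {φ ψ : Fm} : Prf T (φ :: Γ) ψ → Prf T Γ (Fm.imp φ ψ)
  | impE {Γ : List Fm} {φ ψ : Fm} : Prf T Γ (Fm.imp φ ψ) → Prf T Γ φ → Prf T Γ ψ
  | raa {Γ : List Fm} {φ : Fm} : Prf T (φ.neg :: Γ) Fm.bot → Prf T Γ φ
  | allI {Γ : List Fm} {τ : Ty} {φ : Fm} : Prf T (Γ.map (Fm.wk τ)) φ → Prf T Γ (Fm.all τ φ)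
  | allE {Γ : List Fm} {τ : Ty} {φ : Fm} (t : Tm τ) : Prf T Γ (Fm.all τ φ) → Prf T Γ (φ.inst t)
  | eqRefl {Γ : List Fm} (t : Tm Ty.nat) : Prf T Γ (Fm.eq t t)
  | eqSubst {Γ : List Fm} {s t : Tm Ty.nat} (φ : Fm) :
      Prf T Γ (Fm.eq s t) → Prf T Γ (φ.inst s) → Prf T Γ (φ.inst t)

/-- The theory `T` proves `φ`. -/
def Proves (T : Set Fm) (φ : Fm) : Prop := Prf T [] φ

/-! ### Terms and formulas of arithmetic -/

/-- The number variable `var 0 n`. -/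
abbrev nv (n : ℕ) : Tm Ty.nat := Tm.var Ty.nat n
/-- The type `1` variable `var 1 n`. -/
abbrev fv (n : ℕ) : Tm Ty.one := Tm.var Ty.one n

def zero : Tm Ty.nat := Tm.con Con.zero
def succ (t : Tm Ty.nat) : Tm Ty.nat := Tm.app (Tm.con Con.succ) t
def one : Tm Ty.nat := succ zero
def two : Tm Ty.nat := succ one
def add (s t : Tm Ty.nat) : Tm Ty.nat := Tm.app (Tm.app (Tm.con Con.add) s) t
def mul (s t : Tm Ty.nat) : Tm Ty.nat := Tm.app (Tm.app (Tm.con Con.mul) s) t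

def recur (f : Tm (Ty.arr Ty.nat (Ty.arr Ty.nat Ty.nat))) (m n : Tm Ty.nat) : Tm Ty.nat :=
  Tm.app (Tm.app (Tm.app (Tm.con Con.recursor) f) m) n

/-- `Π t`, the constant function with value `t`. -/
def const (σ : Ty) {ρ : Ty} (t : Tm ρ) : Tm (Ty.arr σ ρ) := Tm.app (Tm.con (Con.pi ρ σ)) t

/-- `2 ^ t`, by recursion with the step `fun _ x => 2 * x`. -/
def pow2 (t : Tm Ty.nat) : Tm Ty.nat :=
  recur (const Ty.nat (Tm.app (Tm.con Con.mul) two)) one t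

/-- `s ≤ t`, that is, `∃ z, s + z = t`. -/
def le (s t : Tm Ty.nat) : Fm :=
  Fm.ex Ty.nat (Fm.eq (add (s.wk Ty.nat) (nv 0)) (t.wk Ty.nat))

/-- Extensional equality at all finite types. -/
def eqAt : (τ : Ty) → Tm τ → Tm τ → Fm
  | Ty.nat, s, t => Fm.eq s t
  | Ty.arr σ τ, s, t =>
      Fm.all σ (eqAt τ (Tm.app (s.wk σ) (Tm.var σ 0)) (Tm.app (t.wk σ) (Tm.var σ 0)))

/-! ### The theories -/

/-- The axiom of extensionality: `∀ z x y, x = y → z x = z y`. -/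
def extensionality (ρ τ : Ty) : Fm :=
  Fm.all (Ty.arr ρ τ) (Fm.all ρ (Fm.all ρ (Fm.imp
    (eqAt ρ (Tm.var ρ 1) (Tm.var ρ 0))
    (eqAt τ (Tm.app (Tm.var (Ty.arr ρ τ) 0) (Tm.var ρ 1))
      (Tm.app (Tm.var (Ty.arr ρ τ) 0) (Tm.var ρ 0))))))

/-- Induction for `φ(n)` with `n` the variable `var 0 0`:
`φ(0) → (∀ n, φ(n) → φ(n + 1)) → ∀ n, φ(n)`. -/
def induction (φ : Fm) : Fm :=
  Fm.imp (φ.inst zero) (Fm.imp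
    (Fm.all Ty.nat (Fm.imp φ (φ.subst (Sub.cons Ty.nat (succ (nv 0)) (Sub.wk Ty.nat)))))
    (Fm.all Ty.nat φ))

/-- The axiom of choice for `φ(f, n)` with `f` the variable `var 1 0` and `n` the variable
`var 0 0`: `(∀ f¹, ∃ n⁰, φ(f, n)) → ∃ F², ∀ f¹, φ(f, F f)`. -/
def choice (φ : Fm) : Fm :=
  Fm.imp (Fm.all Ty.one (Fm.ex Ty.nat φ))
    (Fm.ex Ty.two (Fm.all Ty.one
      ((φ.wk Ty.two).inst (Tm.app (Tm.var Ty.two 0) (fv 0)))))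

/-- The axioms of `RCA₀^ω`; parameters of all types are allowed in the schemes. -/
inductive RCA0ω : Set Fm
  | succ_ne_zero (t : Tm Ty.nat) : RCA0ω (Fm.eq (succ t) zero).neg
  | succ_inj (s t : Tm Ty.nat) : RCA0ω (Fm.imp (Fm.eq (succ s) (succ t)) (Fm.eq s t))
  | add_zero (s : Tm Ty.nat) : RCA0ω (Fm.eq (add s zero) s)
  | add_succ (s t : Tm Ty.nat) : RCA0ω (Fm.eq (add s (succ t)) (succ (add s t)))
  | mul_zero (s : Tm Ty.nat) : RCA0ω (Fm.eq (mul s zero) zero)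
  | mul_succ (s t : Tm Ty.nat) : RCA0ω (Fm.eq (mul s (succ t)) (add (mul s t) s))
  | pi {ρ σ : Ty} (s : Tm ρ) (t : Tm σ) :
      RCA0ω (eqAt ρ (Tm.app (Tm.app (Tm.con (Con.pi ρ σ)) s) t) s)
  | sigma {ρ σ τ : Ty} (s : Tm (Ty.arr ρ (Ty.arr σ τ))) (t : Tm (Ty.arr ρ σ)) (u : Tm ρ) :
      RCA0ω (eqAt τ (Tm.app (Tm.app (Tm.app (Tm.con (Con.sigma ρ σ τ)) s) t) u)
        (Tm.app (Tm.app s u) (Tm.app t u)))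
  | recur_zero (f : Tm (Ty.arr Ty.nat (Ty.arr Ty.nat Ty.nat))) (m : Tm Ty.nat) :
      RCA0ω (Fm.eq (recur f m zero) m)
  | recur_succ (f : Tm (Ty.arr Ty.nat (Ty.arr Ty.nat Ty.nat))) (m n : Tm Ty.nat) :
      RCA0ω (Fm.eq (recur f m (succ n)) (Tm.app (Tm.app f n) (recur f m n)))
  | extensionality (ρ τ : Ty) : RCA0ω (extensionality ρ τ)
  | induction (φ : Fm) : φ.QF → RCA0ω (induction φ)
  | choice (φ : Fm) : φ.QF → RCA0ω (choice φ)

/-- The axiom `(∃²)`: there is `E²` with values at most `1` such that, for all `f¹`,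
`(∃ n, f n = 0) ↔ E f = 0`. -/
def existsTwo : Fm :=
  Fm.ex Ty.two (Fm.all Ty.one (Fm.and
    (le (Tm.app (Tm.var Ty.two 0) (fv 0)) one)
    (Fm.iff (Fm.ex Ty.nat (Fm.eq (Tm.app (fv 0) (nv 0)) zero))
      (Fm.eq (Tm.app (Tm.var Ty.two 0) (fv 0)) zero))))

/-- `ACA₀^ω` is `RCA₀^ω` with `(∃²)`. -/
def ACA0ω : Set Fm := RCA0ω ∪ {existsTwo}

/-! ### Real numbers -/

/-- `q` is the Cantor code of the pair `(a, b)`: `2 q = (a + b) (a + b + 1) + 2 b`. -/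
def isPair (q a b : Tm Ty.nat) : Fm :=
  Fm.eq (mul two q) (add (mul (add a b) (succ (add a b))) (mul two b))

/-- `q` is the code of the rational number `(a - b) / (c + 1)`, namely the code of `((a, b), c)`.
Every number codes exactly one triple `(a, b, c)`; the number `0` codes `0`, and `1` codes `1`. -/
def isRat (q a b c : Tm Ty.nat) : Fm :=
  Fm.ex Ty.nat (Fm.and
    (isPair (nv 0) (a.wk Ty.nat) (b.wk Ty.nat))
    (isPair (q.wk Ty.nat) (nv 0) (c.wk Ty.nat)))

/-- `t` inside the scope of six more number quantifiers. -/
def wk6 (t : Tm Ty.nat) : Tm Ty.nat :=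
  (((((t.wk Ty.nat).wk Ty.nat).wk Ty.nat).wk Ty.nat).wk Ty.nat).wk Ty.nat

/-- `q ≤ q' + r / 2 ^ k` for the rational numbers coded by `q` and `q'` and the natural numbers
`r` and `k`. If `q` codes `(a - b) / (c + 1)` and `q'` codes `(a' - b') / (c' + 1)`, this is
`(a (c' + 1) + b' (c + 1)) 2 ^ k ≤ (a' (c + 1) + b (c' + 1)) 2 ^ k + r (c + 1) (c' + 1)`.
The bound variables `a, b, c, a', b', c'` are `nv 5, nv 4, nv 3, nv 2, nv 1, nv 0`. -/
def leRat (q q' r k : Tm Ty.nat) : Fm :=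
  Fm.ex Ty.nat (Fm.ex Ty.nat (Fm.ex Ty.nat (Fm.ex Ty.nat (Fm.ex Ty.nat (Fm.ex Ty.nat
    (Fm.and (isRat (wk6 q) (nv 5) (nv 4) (nv 3))
    (Fm.and (isRat (wk6 q') (nv 2) (nv 1) (nv 0))
      (le
        (mul (add (mul (nv 5) (succ (nv 0))) (mul (nv 1) (succ (nv 3)))) (pow2 (wk6 k)))
        (add
          (mul (add (mul (nv 2) (succ (nv 3))) (mul (nv 4) (succ (nv 0)))) (pow2 (wk6 k)))
          (mul (wk6 r) (mul (succ (nv 3)) (succ (nv 0)))))))))))))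

/-- `|q - q'| ≤ r / 2 ^ k`. -/
def closeRat (q q' r k : Tm Ty.nat) : Fm := Fm.and (leRat q q' r k) (leRat q' q r k)

/-- `x` represents a real number: `∀ k i, |x k - x (k + i)| ≤ 2 ^ (-k)`. -/
def isReal (x : Tm Ty.one) : Fm :=
  Fm.all Ty.nat (Fm.all Ty.nat (closeRat
    (Tm.app ((x.wk Ty.nat).wk Ty.nat) (nv 1))
    (Tm.app ((x.wk Ty.nat).wk Ty.nat) (add (nv 1) (nv 0))) one (nv 1)))

/-- Equality of real numbers: `∀ k, |x k - y k| ≤ 2 ^ (-k + 1)`. -/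
def eqReal (x y : Tm Ty.one) : Fm :=
  Fm.all Ty.nat (closeRat
    (Tm.app (x.wk Ty.nat) (nv 0)) (Tm.app (y.wk Ty.nat) (nv 0)) two (nv 0))

/-- Order of real numbers: `∀ k, x k ≤ y k + 2 ^ (-k + 1)`. -/
def leReal (x y : Tm Ty.one) : Fm :=
  Fm.all Ty.nat (leRat
    (Tm.app (x.wk Ty.nat) (nv 0)) (Tm.app (y.wk Ty.nat) (nv 0)) two (nv 0))

/-! ### Countable sets and their enumerations -/

/-- A space whose points are represented by type `1` objects: which of them represent a point, and
when two of them represent the same point. -/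
structure Space : Type where
  pt : Tm Ty.one → Fm
  same : Tm Ty.one → Tm Ty.one → Fm

/-- The real line. -/
def realLine : Space := ⟨isReal, eqReal⟩

/-- The unit interval `[0,1]`; the constant sequences with value the code of `0` and of `1`
represent the real numbers `0` and `1`. -/
def unitInterval : Space :=
  ⟨fun x => Fm.and (isReal x)
    (Fm.and (leReal (const Ty.nat zero) x) (leReal x (const Ty.nat one))), eqReal⟩

/-- Cantor space `2^ℕ`. -/
def cantorSpace : Space :=
  ⟨fun f => Fm.all Ty.nat (Fm.or
    (Fm.eq (Tm.app (f.wk Ty.nat) (nv 0)) zero) (Fm.eq (Tm.app (f.wk Ty.nat) (nv 0)) one)),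
    eqAt Ty.one⟩

namespace Space

variable (X : Space)

/-- `Y : X → ℕ`, i.e. `Y` takes the same value on representations of the same point. -/
def isFun (Y : Tm Ty.two) : Fm :=
  Fm.all Ty.one (Fm.all Ty.one (Fm.imp (X.pt (fv 1)) (Fm.imp (X.pt (fv 0))
    (Fm.imp (X.same (fv 1) (fv 0))
      (Fm.eq (Tm.app ((Y.wk Ty.one).wk Ty.one) (fv 1))
        (Tm.app ((Y.wk Ty.one).wk Ty.one) (fv 0)))))))

/-- `x ∈ A`, i.e. `A(x) = 1`. -/
def mem (x : Tm Ty.one) (A : Tm Ty.two) : Fm := Fm.eq (Tm.app A x) one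

/-- `A` is a subset of `X`, i.e. `A : X → {0, 1}`. -/
def isSet (A : Tm Ty.two) : Fm :=
  Fm.and (X.isFun A) (Fm.all Ty.one (Fm.imp (X.pt (fv 0))
    (Fm.or (Fm.eq (Tm.app (A.wk Ty.one) (fv 0)) zero)
      (Fm.eq (Tm.app (A.wk Ty.one) (fv 0)) one))))

/-- `A` has an element. -/
def nonempty (A : Tm Ty.two) : Fm :=
  Fm.ex Ty.one (Fm.and (X.pt (fv 0)) (mem (fv 0) (A.wk Ty.one)))

/-- `Y` is injective on `A`. -/
def injOn (Y A : Tm Ty.two) : Fm :=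
  Fm.all Ty.one (Fm.all Ty.one (Fm.imp (X.pt (fv 1)) (Fm.imp (X.pt (fv 0))
    (Fm.imp (mem (fv 1) ((A.wk Ty.one).wk Ty.one)) (Fm.imp (mem (fv 0) ((A.wk Ty.one).wk Ty.one))
      (Fm.imp
        (Fm.eq (Tm.app ((Y.wk Ty.one).wk Ty.one) (fv 1))
          (Tm.app ((Y.wk Ty.one).wk Ty.one) (fv 0)))
        (X.same (fv 1) (fv 0))))))))

/-- Every `n` is the value of `Y` at an element of `A`. -/
def surjOn (Y A : Tm Ty.two) : Fm :=
  Fm.all Ty.nat (Fm.ex Ty.one (Fm.and (X.pt (fv 0))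
    (Fm.and (mem (fv 0) ((A.wk Ty.nat).wk Ty.one))
      (Fm.eq (Tm.app ((Y.wk Ty.nat).wk Ty.one) (fv 0)) (nv 0)))))

/-- `A` is countable: there is `Y : X → ℕ` injective on `A`. -/
def countable (A : Tm Ty.two) : Fm :=
  Fm.ex Ty.two (Fm.and (X.isFun (Tm.var Ty.two 0)) (X.injOn (Tm.var Ty.two 0) (A.wk Ty.two)))

/-- `A` is strongly countable: there is `Y : X → ℕ` bijective on `A`. -/
def stronglyCountable (A : Tm Ty.two) : Fm :=
  Fm.ex Ty.two (Fm.and (X.isFun (Tm.var Ty.two 0))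
    (Fm.and (X.injOn (Tm.var Ty.two 0) (A.wk Ty.two))
      (X.surjOn (Tm.var Ty.two 0) (A.wk Ty.two))))

/-- `A` is enumerable: there is a sequence `(xₙ)` of points of `X` such that, for all `x` in `X`,
`x ∈ A ↔ ∃ n, x = xₙ`. -/
def enumerable (A : Tm Ty.two) : Fm :=
  Fm.ex Ty.seq (Fm.and
    (Fm.all Ty.nat (X.pt (Tm.app (Tm.var Ty.seq 0) (nv 0))))
    (Fm.all Ty.one (Fm.imp (X.pt (fv 0))
      (Fm.iff (mem (fv 0) ((A.wk Ty.seq).wk Ty.one))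
        (Fm.ex Ty.nat (X.same (fv 0) (Tm.app (Tm.var Ty.seq 0) (nv 0))))))))

/-- `cocode₀^X`: every non-empty countable subset of `X` is enumerable. -/
def cocode₀ : Fm :=
  Fm.all Ty.two (Fm.imp (X.isSet (Tm.var Ty.two 0)) (Fm.imp (X.nonempty (Tm.var Ty.two 0))
    (Fm.imp (X.countable (Tm.var Ty.two 0)) (X.enumerable (Tm.var Ty.two 0)))))

/-- `cocode₁^X`: every strongly countable subset of `X` is enumerable. -/
def cocode₁ : Fm :=
  Fm.all Ty.two (Fm.imp (X.isSet (Tm.var Ty.two 0))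
    (Fm.imp (X.stronglyCountable (Tm.var Ty.two 0)) (X.enumerable (Tm.var Ty.two 0))))

end Space

end HOA

/-!
By a Henkin completeness theorem it suffices to prove the equivalences in every structure satisfying
the axioms. The functionals of such a structure are closed under primitive recursion, and under
definition by cases and search for conditions with quantifiers over numbers only, because `∃²` makes
such conditions decidable.

Let the space `X` be a definable retract of the space `Z`. To a countable subset `A` of `X`
corresponds a countable subset of `Z`, namely the set of the points that lie in the image of `X` and
whose retraction lies in `A`; and the retraction maps an enumeration of it to an enumeration of `A`.
So the principles for `Z` imply those for `X`. Now the unit interval is a retract of the line, which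
is one of Cantor space (by lower Dedekind cuts), which is one of the unit interval (by expansions in
base four with digits `0` and `1`).
-/

namespace HOA

/-! ### Substitution -/

namespace Sub

variable {τ ρ : Ty} (t : Tm τ) (s s' : Sub) (n : ℕ)

@[simp] theorem cons_self_zero : Sub.cons τ t s τ 0 = t := by simp [Sub.cons]

@[simp] theorem cons_self_succ : Sub.cons τ t s τ (n + 1) = s τ n := by simp [Sub.cons]

theorem cons_of_ne (h : ρ ≠ τ) : Sub.cons τ t s ρ n = s ρ n := by simp [Sub.cons, h]

variable {s s'} in
theorem ext_at (τ : Ty) (zero : s τ 0 = s' τ 0) (succ : ∀ n, s τ (n + 1) = s' τ (n + 1))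
    (other : ∀ ρ n, ρ ≠ τ → s ρ n = s' ρ n) : s = s' := by
  funext ρ n
  obtain rfl | h := eq_or_ne ρ τ
  · cases n with
    | zero => exact zero
    | succ n => exact succ n
  · exact other ρ n h

/-- The composition of two substitutions: first `s`, then `s'`. -/
def comp (s s' : Sub) : Sub := fun τ n => (s τ n).subst s'

end Sub

section Tm

variable {τ ρ : Ty}

@[simp] theorem Tm.wk_var_self (n : ℕ) : (Tm.var τ n).wk τ = Tm.var τ (n + 1) := by
  simp [Tm.wk, Tm.subst, Sub.wk]

theorem Tm.wk_var_of_ne (n : ℕ) (h : ρ ≠ τ) : (Tm.var ρ n).wk τ = Tm.var ρ n := by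
  simp [Tm.wk, Tm.subst, Sub.wk, h]

theorem Tm.subst_id (t : Tm τ) : t.subst Sub.id = t := by
  induction t with
  | var τ n => rfl
  | con c => rfl
  | app t u iht ihu => simp only [Tm.subst, iht, ihu]

theorem Tm.subst_subst (t : Tm τ) (s s' : Sub) : (t.subst s).subst s' = t.subst (s.comp s') := by
  induction t with
  | var τ n => rfl
  | con c => rfl
  | app t u iht ihu => simp only [Tm.subst, iht, ihu]

theorem Tm.wk_wk_comm (t : Tm ρ) (σ τ : Ty) : (t.wk σ).wk τ = (t.wk τ).wk σ := by
  have comm : (Sub.wk σ).comp (Sub.wk τ) = (Sub.wk τ).comp (Sub.wk σ) := by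
    funext ρ n
    simp only [Sub.comp, Sub.wk, Tm.subst]
    split_ifs <;> rfl
  simp only [Tm.wk, Tm.subst_subst, comm]

theorem Sub.wk_comp_cons (t : Tm τ) (s : Sub) : (Sub.wk τ).comp (Sub.cons τ t s) = s := by
  funext ρ n
  obtain rfl | h := eq_or_ne ρ τ
  · simp [Sub.comp, Sub.wk, Tm.subst]
  · simp [Sub.comp, Sub.wk, Tm.subst, h, Sub.cons_of_ne]

theorem Sub.wk_comp_lift (τ : Ty) (s : Sub) : (Sub.wk τ).comp (s.lift τ) = s.comp (Sub.wk τ) :=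
  Sub.wk_comp_cons _ _

@[simp] theorem Tm.wk_subst_cons (u : Tm ρ) (t : Tm τ) (s : Sub) :
    (u.wk τ).subst (Sub.cons τ t s) = u.subst s := by
  rw [Tm.wk, Tm.subst_subst, Sub.wk_comp_cons]

@[simp] theorem Tm.wk_subst_lift (u : Tm ρ) (s : Sub) :
    (u.wk τ).subst (s.lift τ) = (u.subst s).wk τ :=
  Tm.wk_subst_cons u _ _ |>.trans (Tm.subst_subst u s (Sub.wk τ)).symm

end Tm

namespace Sub

variable {τ ρ : Ty} (s s' : Sub) (n : ℕ)

@[simp] theorem lift_self_zero : s.lift τ τ 0 = Tm.var τ 0 := cons_self_zero _ _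

@[simp] theorem lift_self_succ : s.lift τ τ (n + 1) = (s τ n).wk τ := cons_self_succ _ _ _

theorem lift_of_ne (h : ρ ≠ τ) : s.lift τ ρ n = (s ρ n).wk τ := cons_of_ne _ _ _ h

theorem comp_id : s.comp Sub.id = s := funext₂ fun _ _ => Tm.subst_id _

theorem id_comp : Sub.id.comp s = s := rfl

theorem cons_comp (t : Tm τ) : (cons τ t s).comp s' = cons τ (t.subst s') (s.comp s') :=
  ext_at τ (by simp [comp]) (by simp [comp]) fun ρ n h => by simp [comp, cons_of_ne, h]

theorem lift_comp_cons (t : Tm τ) : (s.lift τ).comp (cons τ t s') = cons τ t (s.comp s') :=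
  ext_at τ (by simp [comp, Tm.subst]) (by simp [comp]) fun ρ n h => by
    simp [comp, cons_of_ne, lift_of_ne, h]

variable (τ)

theorem lift_comp_lift : (s.lift τ).comp (s'.lift τ) = (s.comp s').lift τ :=
  ext_at τ (by simp [comp, Tm.subst]) (by simp [comp]) fun ρ n h => by simp [comp, lift_of_ne, h]

theorem lift_id : Sub.id.lift τ = Sub.id :=
  ext_at τ (by simp [Sub.id]) (by simp [Sub.id]) fun ρ n h => by
    simp [Sub.id, lift_of_ne, Tm.wk_var_of_ne, h]

variable {τ} in
theorem lift_lift_comm {σ : Ty} (h : σ ≠ τ) : (s.lift σ).lift τ = (s.lift τ).lift σ := by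
  apply ext_at τ
  · simp [lift_of_ne, Tm.wk_var_of_ne, h.symm]
  · simp [lift_of_ne, h.symm, Tm.wk_wk_comm _ σ τ]
  · intro ρ n hρ
    obtain rfl | hσ := eq_or_ne ρ σ
    · cases n <;> simp [lift_of_ne, Tm.wk_var_of_ne, h, Tm.wk_wk_comm _ ρ τ]
    · simp [lift_of_ne, hρ, hσ, Tm.wk_wk_comm _ σ τ]

end Sub

namespace Fm

theorem subst_id (φ : Fm) : φ.subst Sub.id = φ := by
  induction φ with
  | eq t u => simp only [Fm.subst, Tm.subst_id]
  | bot => rfl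
  | imp φ ψ ihφ ihψ => simp only [Fm.subst, ihφ, ihψ]
  | all τ φ ih => simp only [Fm.subst, Sub.lift_id, ih]

theorem subst_subst (φ : Fm) (s s' : Sub) : (φ.subst s).subst s' = φ.subst (s.comp s') := by
  induction φ generalizing s s' with
  | eq t u => simp only [Fm.subst, Tm.subst_subst]
  | bot => rfl
  | imp φ ψ ihφ ihψ => simp only [Fm.subst, ihφ, ihψ]
  | all τ φ ih => simp only [Fm.subst, ih, Sub.lift_comp_lift]

variable {τ : Ty} (φ : Fm) (s : Sub) (t : Tm τ)

theorem subst_lift_inst : (φ.subst (s.lift τ)).inst t = φ.subst (Sub.cons τ t s) := by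
  rw [Fm.inst, subst_subst, Sub.lift_comp_cons, Sub.comp_id]

theorem inst_subst : (φ.inst t).subst s = (φ.subst (s.lift τ)).inst (t.subst s) := by
  rw [subst_lift_inst, Fm.inst, subst_subst, Sub.cons_comp, Sub.id_comp]

theorem wk_subst_lift : (φ.wk τ).subst (s.lift τ) = (φ.subst s).wk τ := by
  rw [Fm.wk, Fm.wk, subst_subst, subst_subst, Sub.wk_comp_lift]

variable {φ} in
theorem QF.subst (h : φ.QF) (s : Sub) : (φ.subst s).QF := by
  induction φ generalizing s with
  | eq t u => trivial
  | bot => trivial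
  | imp φ ψ ihφ ihψ => exact ⟨ihφ h.1 s, ihψ h.2 s⟩
  | all τ φ => exact h.elim

end Fm

theorem eqAt_subst {τ : Ty} (t u : Tm τ) (s : Sub) :
    (eqAt τ t u).subst s = eqAt τ (t.subst s) (u.subst s) := by
  induction τ generalizing s with
  | nat => rfl
  | arr σ τ _ ih => simp only [eqAt, Fm.subst, ih, Tm.subst, Tm.wk_subst_lift, Sub.lift_self_zero]

/-! ### Axiom systems closed under substitution -/

theorem Ty.ne_arr_left (σ τ : Ty) : σ ≠ Ty.arr σ τ := fun h => by
  have := congrArg sizeOf h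
  simp only [Ty.arr.sizeOf_spec] at this
  omega

theorem extensionality_subst (ρ τ : Ty) (s : Sub) :
    (extensionality ρ τ).subst s = extensionality ρ τ := by
  have h := (Ty.ne_arr_left ρ τ).symm
  have h₁ : ((s.lift (Ty.arr ρ τ)).lift ρ).lift ρ ρ 1 = Tm.var ρ 1 := by
    simp
  have h₂ : ((s.lift (Ty.arr ρ τ)).lift ρ).lift ρ (Ty.arr ρ τ) 0 = Tm.var (Ty.arr ρ τ) 0 := by
    simp [Sub.lift_of_ne _ _ h, Tm.wk_var_of_ne _ h]
  simp only [extensionality, Fm.subst, eqAt_subst, Tm.subst, Sub.lift_self_zero, h₁, h₂]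

theorem induction_subst (φ : Fm) (s : Sub) :
    (induction φ).subst s = induction (φ.subst (s.lift Ty.nat)) := by
  have h : (Sub.cons Ty.nat (succ (nv 0)) (Sub.wk Ty.nat)).comp (s.lift Ty.nat) =
      (s.lift Ty.nat).comp (Sub.cons Ty.nat (succ (nv 0)) (Sub.wk Ty.nat)) := by
    rw [Sub.cons_comp, Sub.wk_comp_lift, Sub.lift_comp_cons]
    simp [succ, Tm.subst]
  simp only [induction, Fm.subst, Fm.inst_subst, Fm.subst_subst, h, zero, Tm.subst]

theorem choice_subst (φ : Fm) (s : Sub) :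
    (choice φ).subst s = choice (φ.subst ((s.lift Ty.one).lift Ty.nat)) := by
  have h : ((s.lift Ty.two).lift Ty.one).lift Ty.nat =
      ((s.lift Ty.one).lift Ty.nat).lift Ty.two := by
    rw [Sub.lift_lift_comm (σ := Ty.two) (τ := Ty.one) _ (by simp),
      Sub.lift_lift_comm (σ := Ty.two) (τ := Ty.nat) _ (by simp)]
  have h' : ((Tm.var Ty.two 0).app (fv 0)).subst ((s.lift Ty.two).lift Ty.one) =
      (Tm.var Ty.two 0).app (fv 0) := by
    simp [Tm.subst, Sub.lift_of_ne, Tm.wk_var_of_ne]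
  simp only [choice, Fm.subst, Fm.ex, Fm.neg, Fm.inst_subst, h, h', Fm.wk_subst_lift]

theorem existsTwo_subst (s : Sub) : existsTwo.subst s = existsTwo := by
  simp [existsTwo, Fm.subst, Fm.ex, Fm.and, Fm.iff, Fm.neg, le, Tm.subst, Sub.lift, Sub.cons,
    Tm.wk, Sub.wk, add, one, succ, zero]

/-- `T` is closed under substitution: as `Prf` reads its axioms universally closed, this makes the
derivations from `T` closed under substitution too. -/
def SubstClosed (T : Set Fm) : Prop := ∀ φ ∈ T, ∀ s : Sub, φ.subst s ∈ T

theorem substClosed_ACA0ω : SubstClosed ACA0ω := by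
  rintro φ (h | rfl) s
  · refine Or.inl ?_
    cases h with
    | succ_ne_zero t => exact RCA0ω.succ_ne_zero (t.subst s)
    | succ_inj t u => exact RCA0ω.succ_inj (t.subst s) (u.subst s)
    | add_zero t => exact RCA0ω.add_zero (t.subst s)
    | add_succ t u => exact RCA0ω.add_succ (t.subst s) (u.subst s)
    | mul_zero t => exact RCA0ω.mul_zero (t.subst s)
    | mul_succ t u => exact RCA0ω.mul_succ (t.subst s) (u.subst s)
    | pi t u => rw [eqAt_subst]; exact RCA0ω.pi (t.subst s) (u.subst s)
    | sigma t u v => rw [eqAt_subst]; exact RCA0ω.sigma (t.subst s) (u.subst s) (v.subst s)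
    | recur_zero f m => exact RCA0ω.recur_zero (f.subst s) (m.subst s)
    | recur_succ f m n => exact RCA0ω.recur_succ (f.subst s) (m.subst s) (n.subst s)
    | extensionality ρ τ => rw [extensionality_subst]; exact RCA0ω.extensionality ρ τ
    | induction φ h => rw [induction_subst]; exact RCA0ω.induction _ (h.subst _)
    | choice φ h => rw [choice_subst]; exact RCA0ω.choice _ (h.subst _)
  · exact Or.inr (existsTwo_subst s)

/-! ### Structural rules -/

namespace Prf

variable {T : Set Fm} {Γ Δ : List Fm} {φ : Fm}

theorem weaken (h : Prf T Γ φ) (hs : Γ ⊆ Δ) : Prf T Δ φ := by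
  induction h generalizing Δ with
  | ax h => exact ax h
  | hyp h => exact hyp (hs h)
  | impI _ ih => exact impI (ih (List.cons_subset_cons _ hs))
  | impE _ _ ih₁ ih₂ => exact impE (ih₁ hs) (ih₂ hs)
  | raa _ ih => exact raa (ih (List.cons_subset_cons _ hs))
  | allI _ ih => exact allI (ih (List.map_subset _ hs))
  | allE t _ ih => exact allE t (ih hs)
  | eqRefl t => exact eqRefl t
  | eqSubst φ _ _ ih₁ ih₂ => exact eqSubst φ (ih₁ hs) (ih₂ hs)

theorem subst (hT : SubstClosed T) (h : Prf T Γ φ) (s : Sub) :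
    Prf T (Γ.map (Fm.subst s)) (φ.subst s) := by
  induction h generalizing s with
  | ax h => exact ax (hT _ h s)
  | hyp h => exact hyp (List.mem_map_of_mem h)
  | impI _ ih => exact impI (ih s)
  | impE _ _ ih₁ ih₂ => exact impE (ih₁ s) (ih₂ s)
  | raa _ ih => exact raa (ih s)
  | @allI Γ τ φ _ ih =>
    have hΓ : (Γ.map (Fm.wk τ)).map (Fm.subst (s.lift τ)) =
        (Γ.map (Fm.subst s)).map (Fm.wk τ) := by
      simp only [List.map_map, Function.comp_def, Fm.wk_subst_lift]
    exact allI (hΓ ▸ ih (s.lift τ))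
  | allE t _ ih =>
    rw [Fm.inst_subst]
    exact allE _ (ih s)
  | eqRefl t => exact eqRefl _
  | eqSubst φ _ _ ih₁ ih₂ =>
    rw [Fm.inst_subst]
    exact eqSubst _ (ih₁ s) (Fm.inst_subst φ s _ ▸ ih₂ s)

end Prf

/-! ### Countability of the language -/

theorem countable_of_rank {ι : Type*} {α : ι → Type*} (r : ∀ i, α i → ℕ)
    (h : ∀ n, (∀ i, {x | r i x < n}.Countable) → ∀ i, {x | r i x = n}.Countable) (i : ι) :
    Countable (α i) := by
  have hn : ∀ n i, {x | r i x = n}.Countable := fun n => by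
    induction n using Nat.strong_induction_on with
    | _ n ih =>
      refine h n fun i => ?_
      have hlt : {x | r i x < n} = ⋃ m ∈ Set.Iio n, {x | r i x = m} := by ext; simp
      exact hlt ▸ (Set.to_countable (Set.Iio n)).biUnion fun m hm => ih m hm i
  have huniv : (Set.univ : Set (α i)) = ⋃ n, {x | r i x = n} := by ext; simp
  exact Set.countable_univ_iff.1 (huniv ▸ Set.countable_iUnion fun n => hn n i)

instance : Countable Ty := by
  refine countable_of_rank (α := fun _ : Unit => Ty) (fun _ => sizeOf) (fun n hn i => ?_) ()
  refine ((Set.countable_singleton Ty.nat).union ((hn i).image2 (hn i) Ty.arr)).mono ?_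
  rintro (_ | ⟨σ, τ⟩) hr
  · exact Or.inl rfl
  · rw [Set.mem_ofPred_eq, Ty.arr.sizeOf_spec] at hr
    exact Or.inr ⟨σ, by grind, τ, by grind, rfl⟩

instance : Countable (Σ τ, Con τ) := by
  let base : Set (Σ τ, Con τ) :=
    {⟨_, Con.zero⟩, ⟨_, Con.succ⟩, ⟨_, Con.add⟩, ⟨_, Con.mul⟩, ⟨_, Con.recursor⟩}
  refine Set.countable_univ_iff.1 (((base.to_countable.union (Set.countable_range
    fun p : Ty × Ty => ⟨_, Con.pi p.1 p.2⟩)).union (Set.countable_range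
      fun p : Ty × Ty × Ty => ⟨_, Con.sigma p.1 p.2.1 p.2.2⟩)).mono ?_)
  rintro ⟨_, c⟩ -
  cases c with
  | pi ρ σ => exact Or.inl (Or.inr ⟨(ρ, σ), rfl⟩)
  | sigma ρ σ τ => exact Or.inr ⟨(ρ, σ, τ), rfl⟩
  | _ => simp [base]

instance (τ : Ty) : Countable (Con τ) :=
  (sigma_mk_injective (β := Con) (i := τ)).countable

instance (τ : Ty) : Countable (Tm τ) := by
  refine countable_of_rank (fun _ => sizeOf) (fun n hn τ => ?_) τ
  refine (((Set.countable_range (Tm.var τ)).union (Set.countable_range Tm.con)).union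
    (Set.countable_iUnion fun σ => (hn (Ty.arr σ τ)).image2 (hn σ) Tm.app)).mono ?_
  rintro (_ | _ | @⟨σ, _, s, t⟩) hr
  · exact Or.inl (Or.inl ⟨_, rfl⟩)
  · exact Or.inl (Or.inr ⟨_, rfl⟩)
  · rw [Set.mem_ofPred_eq, Tm.app.sizeOf_spec] at hr
    exact Or.inr (Set.mem_iUnion.2 ⟨σ, s, by grind, t, by grind, rfl⟩)

instance : Countable Fm := by
  refine countable_of_rank (α := fun _ : Unit => Fm) (fun _ => sizeOf) (fun n hn i => ?_) ()
  refine ((((Set.countable_univ.image2 Set.countable_univ Fm.eq).union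
    (Set.countable_singleton Fm.bot)).union ((hn i).image2 (hn i) Fm.imp)).union
    (Set.countable_univ.image2 (hn i) Fm.all)).mono ?_
  rintro (⟨s, t⟩ | _ | ⟨φ, ψ⟩ | ⟨τ, φ⟩) hr
  · exact Or.inl (Or.inl (Or.inl ⟨s, trivial, t, trivial, rfl⟩))
  · exact Or.inl (Or.inl (Or.inr rfl))
  · rw [Set.mem_ofPred_eq, Fm.imp.sizeOf_spec] at hr
    exact Or.inl (Or.inr ⟨φ, by grind, ψ, by grind, rfl⟩)
  · rw [Set.mem_ofPred_eq, Fm.all.sizeOf_spec] at hr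
    exact Or.inr ⟨τ, trivial, φ, by grind, rfl⟩

/-! ### Fresh variables -/

/-- A strict upper bound for the indices of the variables that occur in `t`. -/
def Tm.bound : {τ : Ty} → Tm τ → ℕ
  | _, Tm.var _ n => n + 1
  | _, Tm.con _ => 0
  | _, Tm.app t u => max t.bound u.bound

/-- A strict upper bound for the indices of the variables, free or bound, that occur in `φ`. -/
def Fm.bound : Fm → ℕ
  | Fm.eq t u => max t.bound u.bound
  | Fm.bot => 0
  | Fm.imp φ ψ => max φ.bound ψ.bound
  | Fm.all _ φ => φ.bound

theorem Tm.subst_congr {τ : Ty} (t : Tm τ) {s s' : Sub}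
    (h : ∀ ρ n, n < t.bound → s ρ n = s' ρ n) : t.subst s = t.subst s' := by
  induction t with
  | var τ n => exact h τ n (Nat.lt_succ_self n)
  | con c => rfl
  | app t u iht ihu =>
    simp only [Tm.bound, lt_max_iff] at h
    simp only [Tm.subst, iht fun ρ n hn => h ρ n (Or.inl hn), ihu fun ρ n hn => h ρ n (Or.inr hn)]

theorem Fm.subst_congr (φ : Fm) {s s' : Sub}
    (h : ∀ ρ n, n < φ.bound → s ρ n = s' ρ n) : φ.subst s = φ.subst s' := by
  induction φ generalizing s s' with
  | eq t u =>
    simp only [Fm.bound, lt_max_iff] at h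
    simp only [Fm.subst, t.subst_congr fun ρ n hn => h ρ n (Or.inl hn),
      u.subst_congr fun ρ n hn => h ρ n (Or.inr hn)]
  | bot => rfl
  | imp φ ψ ihφ ihψ =>
    simp only [Fm.bound, lt_max_iff] at h
    simp only [Fm.subst, ihφ fun ρ n hn => h ρ n (Or.inl hn),
      ihψ fun ρ n hn => h ρ n (Or.inr hn)]
  | all τ φ ih =>
    refine congrArg (Fm.all τ) (ih fun ρ n hn => ?_)
    by_cases hρ : ρ = τ
    · subst hρ
      cases n with
      | zero => simp only [Sub.lift_self_zero]
      | succ n => simp only [Sub.lift_self_succ, h ρ n (lt_of_le_of_lt (Nat.le_succ n) hn)]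
    · simp only [Sub.lift_of_ne _ _ hρ, h ρ n hn]

/-- The renaming of `var τ k` to `var τ 0`, with room made for the latter. Applied to formulas with
all indices below `k`, it turns the fresh variable `var τ k` into one that can be bound. -/
def Sub.capture (τ : Ty) (k : ℕ) : Sub := fun ρ n =>
  if ρ = τ ∧ n = k then Tm.var ρ 0 else Sub.wk τ ρ n

theorem Fm.subst_capture {φ : Fm} {τ : Ty} {k : ℕ} (h : φ.bound ≤ k) :
    φ.subst (Sub.capture τ k) = φ.wk τ :=
  φ.subst_congr fun _ _ hn => if_neg fun h' => (hn.trans_le h).ne h'.2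

theorem Fm.inst_capture {φ : Fm} {τ : Ty} {k : ℕ} (h : φ.bound ≤ k) :
    (φ.inst (Tm.var τ k)).subst (Sub.capture τ k) = φ := by
  rw [Fm.inst, Fm.subst_subst]
  conv_rhs => rw [← φ.subst_id]
  refine φ.subst_congr fun ρ n hn => ?_
  by_cases hρ : ρ = τ
  · subst hρ
    cases n with
    | zero => simp [Sub.comp, Tm.subst, Sub.capture, Sub.id]
    | succ n =>
      have : n ≠ k := by omega
      simp [Sub.comp, Tm.subst, Sub.capture, Sub.id, Sub.wk, this]
  · simp [Sub.comp, Sub.cons_of_ne, hρ, Tm.subst, Sub.capture, Sub.id, Sub.wk]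

theorem Prf.allI_fresh {T : Set Fm} (hT : SubstClosed T) {Γ : List Fm} {τ : Ty} {φ : Fm} {k : ℕ}
    (hΓ : ∀ ψ ∈ Γ, ψ.bound ≤ k) (hφ : φ.bound ≤ k) (h : Prf T Γ (φ.inst (Tm.var τ k))) :
    Prf T Γ (Fm.all τ φ) := by
  have hcapture := h.subst hT (Sub.capture τ k)
  rw [Fm.inst_capture hφ, List.map_congr_left fun ψ hψ => Fm.subst_capture (hΓ ψ hψ)] at hcapture
  exact Prf.allI hcapture

/-! ### Henkin sets -/

theorem Prf.exfalso {T : Set Fm} {Γ : List Fm} {φ : Fm} (h : Prf T Γ Fm.bot) : Prf T Γ φ :=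
  Prf.raa (h.weaken (List.subset_cons_self _ _))

/-- A consistent, deductively closed and complete set of formulas that contains a counterexample to
each universal formula it refutes. -/
structure IsHenkin (T : Set Fm) (H : Set Fm) : Prop where
  closed : ∀ (Γ : List Fm) (φ : Fm), (∀ ψ ∈ Γ, ψ ∈ H) → Prf T Γ φ → φ ∈ H
  bot_notMem : Fm.bot ∉ H
  complete : ∀ φ, φ ∈ H ∨ φ.neg ∈ H
  witness : ∀ (τ : Ty) (φ : Fm), (Fm.all τ φ).neg ∈ H → ∃ t : Tm τ, (φ.inst t).neg ∈ H

/-- The finite lists of assumptions consistent with `T`, preordered by inclusion. A Henkin set is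
the union of a sufficiently generic ideal of this preorder. -/
def ConsistentList (T : Set Fm) : Type := {Γ : List Fm // ¬ Prf T Γ Fm.bot}

namespace ConsistentList

variable {T : Set Fm}

instance : Preorder (ConsistentList T) := Preorder.lift fun Γ => {φ | φ ∈ Γ.1}

theorem exists_ge_mem_or_neg_mem (Γ : ConsistentList T) (φ : Fm) :
    ∃ Δ, Γ ≤ Δ ∧ (φ ∈ Δ.1 ∨ φ.neg ∈ Δ.1) := by
  by_cases h : Prf T (φ :: Γ.1) Fm.bot
  · exact ⟨⟨φ.neg :: Γ.1, fun h' => Γ.2 (Prf.impE (Prf.impI h) (Prf.raa h'))⟩,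
      List.subset_cons_self _ _, Or.inr List.mem_cons_self⟩
  · exact ⟨⟨φ :: Γ.1, h⟩, List.subset_cons_self _ _, Or.inl List.mem_cons_self⟩

theorem exists_ge_all_mem_or_neg_inst_mem (hT : SubstClosed T) (Γ : ConsistentList T) (τ : Ty)
    (φ : Fm) : ∃ Δ, Γ ≤ Δ ∧ (Fm.all τ φ ∈ Δ.1 ∨ ∃ t : Tm τ, (φ.inst t).neg ∈ Δ.1) := by
  by_cases h : Prf T (Fm.all τ φ :: Γ.1) Fm.bot
  · obtain ⟨k, hk⟩ : ∃ k, ∀ ψ ∈ φ :: Γ.1, ψ.bound ≤ k :=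
      ⟨((φ :: Γ.1).map Fm.bound).sum,
        fun ψ hψ => List.single_le_sum (by simp) _ (List.mem_map_of_mem hψ)⟩
    have hfresh (h' : Prf T ((φ.inst (Tm.var τ k)).neg :: Γ.1) Fm.bot) : Prf T Γ.1 (Fm.all τ φ) :=
      Prf.allI_fresh hT (fun ψ hψ => hk ψ (List.mem_cons_of_mem _ hψ)) (hk φ List.mem_cons_self)
        (Prf.raa h')
    exact ⟨⟨_, fun h' => Γ.2 (Prf.impE (Prf.impI h) (hfresh h'))⟩, List.subset_cons_self _ _,
      Or.inr ⟨_, List.mem_cons_self⟩⟩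
  · exact ⟨⟨_, h⟩, List.subset_cons_self _ _, Or.inl List.mem_cons_self⟩

/-- The dense sets a Henkin set has to meet: those that decide a given formula, and those that
either affirm a given universal formula or provide a counterexample to it. -/
def requirement (hT : SubstClosed T) : Fm ⊕ Ty × Fm → Order.Cofinal (ConsistentList T)
  | Sum.inl φ => ⟨{Δ | φ ∈ Δ.1 ∨ φ.neg ∈ Δ.1}, fun Γ =>
      have ⟨Δ, hle, hΔ⟩ := Γ.exists_ge_mem_or_neg_mem φ
      ⟨Δ, hΔ, hle⟩⟩
  | Sum.inr (τ, φ) => ⟨{Δ | Fm.all τ φ ∈ Δ.1 ∨ ∃ t : Tm τ, (φ.inst t).neg ∈ Δ.1}, fun Γ =>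
      have ⟨Δ, hle, hΔ⟩ := Γ.exists_ge_all_mem_or_neg_inst_mem hT τ φ
      ⟨Δ, hΔ, hle⟩⟩

theorem exists_mem_ideal_subset (I : Order.Ideal (ConsistentList T)) (Γ : List Fm)
    (h : ∀ φ ∈ Γ, ∃ Δ ∈ I, φ ∈ Δ.1) : ∃ Δ ∈ I, Γ ⊆ Δ.1 := by
  induction Γ with
  | nil => exact I.nonempty.imp fun Δ hΔ => ⟨hΔ, List.nil_subset _⟩
  | cons φ Γ ih =>
    obtain ⟨Δ, hΔ, hφ⟩ := h φ List.mem_cons_self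
    obtain ⟨Θ, hΘ, hΓ⟩ := ih fun ψ hψ => h ψ (List.mem_cons_of_mem _ hψ)
    obtain ⟨Λ, hΛ, hΔΛ, hΘΛ⟩ := I.directed Δ hΔ Θ hΘ
    exact ⟨Λ, hΛ, List.cons_subset.2 ⟨hΔΛ hφ, fun ψ hψ => hΘΛ (hΓ hψ)⟩⟩

theorem isHenkin_of_meets (hT : SubstClosed T) (I : Order.Ideal (ConsistentList T))
    (hI : ∀ i, ∃ Δ ∈ requirement hT i, Δ ∈ I) : IsHenkin T {φ | ∃ Δ ∈ I, φ ∈ Δ.1} := by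
  have hconsistent : ∀ Γ : List Fm, (∀ φ ∈ Γ, ∃ Δ ∈ I, φ ∈ Δ.1) → ¬ Prf T Γ Fm.bot :=
    fun Γ hΓ h =>
      have ⟨Δ, _, hΔ⟩ := exists_mem_ideal_subset I Γ hΓ
      Δ.2 (h.weaken hΔ)
  refine ⟨fun Γ φ hΓ h => ?_, fun h => ?_, fun φ => ?_, fun τ φ h => ?_⟩
  · obtain ⟨Δ, hφ | hφ, hΔ⟩ := hI (Sum.inl φ)
    · exact ⟨Δ, hΔ, hφ⟩
    · exact absurd (Prf.impE (Prf.hyp List.mem_cons_self) (h.weaken (List.subset_cons_self _ _)))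
        (hconsistent (φ.neg :: Γ) (List.forall_mem_cons.2 ⟨⟨Δ, hΔ, hφ⟩, hΓ⟩))
  · exact hconsistent [Fm.bot] (by simpa using h) (Prf.hyp List.mem_cons_self)
  · obtain ⟨Δ, hφ, hΔ⟩ := hI (Sum.inl φ)
    exact hφ.imp (fun hφ => ⟨Δ, hΔ, hφ⟩) fun hφ => ⟨Δ, hΔ, hφ⟩
  · obtain ⟨Δ, hφ | ⟨t, ht⟩, hΔ⟩ := hI (Sum.inr (τ, φ))
    · exact absurd (Prf.impE (φ := Fm.all τ φ) (Prf.hyp (by simp [Fm.neg])) (Prf.hyp (by simp)))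
        (hconsistent [Fm.all τ φ, (Fm.all τ φ).neg] (by simpa using ⟨⟨Δ, hΔ, hφ⟩, h⟩))
    · exact ⟨t, Δ, hΔ, ht⟩

end ConsistentList

theorem exists_isHenkin {T : Set Fm} (hT : SubstClosed T) {Γ : List Fm}
    (hΓ : ¬ Prf T Γ Fm.bot) : ∃ H, IsHenkin T H ∧ ∀ φ ∈ Γ, φ ∈ H := by
  have := Encodable.ofCountable (Fm ⊕ Ty × Fm)
  let p : ConsistentList T := ⟨Γ, hΓ⟩
  let D := ConsistentList.requirement hT
  exact ⟨_, ConsistentList.isHenkin_of_meets hT (Order.idealOfCofinals p D)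
    (Order.cofinal_meets_idealOfCofinals p D),
    fun φ hφ => ⟨p, Order.mem_idealOfCofinals p D, hφ⟩⟩

/-! ### Structures and satisfaction -/

/-- An extensional structure for the language: a domain for each type, application, and values of
the constants. Functional types need not be interpreted by full function spaces. -/
structure Str where
  El : Ty → Type
  app {σ τ : Ty} : El (Ty.arr σ τ) → El σ → El τ
  con {τ : Ty} : Con τ → El τ
  ext {σ τ : Ty} {f g : El (Ty.arr σ τ)} : (∀ x, app f x = app g x) → f = g

namespace Str

instance (M : Str) (σ τ : Ty) : CoeFun (M.El (Ty.arr σ τ)) (fun _ => M.El σ → M.El τ) := ⟨M.app⟩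

/-- An assignment of values to all variables. -/
abbrev Asg (M : Str) : Type := (τ : Ty) → ℕ → M.El τ

variable {M : Str}

namespace Asg

/-- `var τ 0 ↦ x`, `var τ (n + 1) ↦ e τ n`, and `e` on the variables of other types. -/
def cons {τ : Ty} (x : M.El τ) (e : M.Asg) : M.Asg := fun ρ n =>
  if h : ρ = τ then
    match n with
    | 0 => h ▸ x
    | k + 1 => e ρ k
  else e ρ n

variable {ρ τ : Ty} (x : M.El τ) (e : M.Asg) (n : ℕ)

@[simp]
theorem cons_self_zero : cons x e τ 0 = x := by simp [cons]

@[simp]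
theorem cons_self_succ : cons x e τ (n + 1) = e τ n := by simp [cons]

theorem cons_of_ne (h : ρ ≠ τ) : cons x e ρ n = e ρ n := by simp [cons, h]

end Asg

/-- The value of a term. -/
def eval (e : M.Asg) : {τ : Ty} → Tm τ → M.El τ
  | _, Tm.var τ n => e τ n
  | _, Tm.con c => M.con c
  | _, Tm.app t u => M.app (eval e t) (eval e u)

/-- Satisfaction of a formula. -/
def Sat : M.Asg → Fm → Prop
  | e, Fm.eq t u => eval e t = eval e u
  | _, Fm.bot => False
  | e, Fm.imp φ ψ => Sat e φ → Sat e ψ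
  | e, Fm.all τ φ => ∀ x : M.El τ, Sat (Asg.cons x e) φ

/-- `M` satisfies the universal closure of each axiom. -/
def Models (M : Str) (T : Set Fm) : Prop := ∀ φ ∈ T, ∀ e : M.Asg, Sat e φ

variable {σ τ : Ty} (e : M.Asg) (φ ψ : Fm)

theorem eval_subst (s : Sub) (t : Tm τ) :
    eval e (t.subst s) = eval (fun ρ n => eval e (s ρ n)) t := by
  induction t with
  | var τ n => rfl
  | con c => rfl
  | app t u iht ihu => simp only [Tm.subst, eval, iht, ihu]

theorem eval_wk (x : M.El σ) (t : Tm τ) : eval (Asg.cons x e) (t.wk σ) = eval e t := by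
  rw [Tm.wk, eval_subst]
  congr 1
  funext ρ n
  by_cases h : ρ = σ
  · subst h
    simp [Sub.wk, eval]
  · simp [Sub.wk, eval, Asg.cons_of_ne, h]

theorem sat_eq (t u : Tm Ty.nat) : Sat e (Fm.eq t u) ↔ eval e t = eval e u := Iff.rfl

theorem sat_imp : Sat e (Fm.imp φ ψ) ↔ (Sat e φ → Sat e ψ) := Iff.rfl

theorem sat_all : Sat e (Fm.all τ φ) ↔ ∀ x : M.El τ, Sat (Asg.cons x e) φ := Iff.rfl

theorem sat_neg : Sat e φ.neg ↔ ¬ Sat e φ := Iff.rfl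

theorem sat_or : Sat e (φ.or ψ) ↔ Sat e φ ∨ Sat e ψ := by
  rw [Fm.or, sat_imp, sat_neg, or_iff_not_imp_left]

theorem sat_and : Sat e (φ.and ψ) ↔ Sat e φ ∧ Sat e ψ := by
  simp only [Fm.and, sat_imp, sat_neg, Classical.not_imp, not_not]

theorem sat_iff : Sat e (φ.iff ψ) ↔ (Sat e φ ↔ Sat e ψ) := by
  rw [Fm.iff, sat_and, sat_imp, sat_imp, ← iff_def]

theorem sat_ex : Sat e (Fm.ex τ φ) ↔ ∃ x : M.El τ, Sat (Asg.cons x e) φ := by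
  simp only [Fm.ex, sat_all, sat_neg, not_forall, not_not]

theorem sat_subst (s : Sub) : Sat e (φ.subst s) ↔ Sat (fun ρ n => eval e (s ρ n)) φ := by
  induction φ generalizing e s with
  | eq t u => rw [Fm.subst, sat_eq, sat_eq, eval_subst, eval_subst]
  | bot => rfl
  | imp φ ψ ihφ ihψ => rw [Fm.subst, sat_imp, sat_imp, ihφ, ihψ]
  | all τ φ ih =>
    refine forall_congr' fun x => (ih _ _).trans (iff_of_eq (congrArg (Sat · φ) ?_))
    funext ρ n
    by_cases h : ρ = τ
    · subst h
      cases n with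
      | zero => rw [Sub.lift_self_zero, eval, Asg.cons_self_zero, Asg.cons_self_zero]
      | succ n => rw [Sub.lift_self_succ, eval_wk, Asg.cons_self_succ]
    · rw [Sub.lift_of_ne _ _ h, eval_wk, Asg.cons_of_ne _ _ _ h]

theorem sat_eqAt (t u : Tm τ) : Sat e (eqAt τ t u) ↔ eval e t = eval e u := by
  induction τ generalizing e with
  | nat => rfl
  | arr σ τ _ ih =>
    simp only [eqAt, sat_all, ih, eval, eval_wk, Asg.cons_self_zero]
    exact ⟨M.ext, fun h x => by rw [h]⟩

end Str

/-! ### The term model of a Henkin set -/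

namespace IsHenkin

variable {T H : Set Fm} (hH : IsHenkin T H) (hE : ∀ ρ τ, extensionality ρ τ ∈ T)
variable {σ τ : Ty} {φ ψ : Fm}

section

include hH

theorem mem_of_mem_axioms (h : φ ∈ T) : φ ∈ H := hH.closed [] φ (by simp) (Prf.ax h)

theorem imp_mem_iff : Fm.imp φ ψ ∈ H ↔ (φ ∈ H → ψ ∈ H) := by
  constructor
  · intro h hφ
    exact hH.closed [Fm.imp φ ψ, φ] ψ (by simp [h, hφ])
      (Prf.impE (Prf.hyp (φ := Fm.imp φ ψ) (by simp)) (Prf.hyp (by simp)))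
  · intro h
    rcases hH.complete φ with hφ | hφ
    · exact hH.closed [ψ] _ (by simp [h hφ]) (Prf.impI (Prf.hyp (by simp)))
    · exact hH.closed [φ.neg] _ (by simp [hφ]) (Prf.impI (Prf.exfalso
        (Prf.impE (Prf.hyp (φ := φ.neg) (by simp)) (Prf.hyp (by simp)))))

theorem neg_mem_iff : φ.neg ∈ H ↔ φ ∉ H := by
  rw [Fm.neg, hH.imp_mem_iff]
  exact imp_congr_right fun _ => iff_false_intro hH.bot_notMem

theorem all_mem_iff : Fm.all τ φ ∈ H ↔ ∀ t : Tm τ, φ.inst t ∈ H := by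
  refine ⟨fun h t => hH.closed [Fm.all τ φ] _ (by simp [h]) (Prf.allE t (Prf.hyp (by simp))), ?_⟩
  contrapose!
  intro h
  obtain ⟨t, ht⟩ := hH.witness τ φ (hH.neg_mem_iff.2 h)
  exact ⟨t, hH.neg_mem_iff.1 ht⟩

theorem eqAt_arr_mem_iff {t u : Tm (Ty.arr σ τ)} :
    eqAt (Ty.arr σ τ) t u ∈ H ↔ ∀ v : Tm σ, eqAt τ (t.app v) (u.app v) ∈ H := by
  simp only [eqAt, hH.all_mem_iff, Fm.inst, eqAt_subst, Tm.subst, Tm.wk_subst_cons, Tm.subst_id,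
    Sub.cons_self_zero]

theorem eqAt_refl (t : Tm τ) : eqAt τ t t ∈ H := by
  induction τ with
  | nat => exact hH.closed [] _ (by simp) (Prf.eqRefl t)
  | arr σ τ _ ih => exact hH.eqAt_arr_mem_iff.2 fun v => ih _

theorem eqAt_right_euclidean {t u v : Tm τ} (h : eqAt τ t u ∈ H) (h' : eqAt τ t v ∈ H) :
    eqAt τ u v ∈ H := by
  induction τ with
  | nat =>
    have hsubst := Prf.eqSubst (T := T) (Γ := [Fm.eq t u, Fm.eq t v]) (s := t) (t := u)
      (Fm.eq (nv 0) (v.wk Ty.nat)) (Prf.hyp (by simp))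
    simp only [Fm.inst, Fm.subst, Tm.subst, Tm.wk_subst_cons, Tm.subst_id,
      Sub.cons_self_zero] at hsubst
    exact hH.closed [Fm.eq t u, Fm.eq t v] _
      (List.forall_mem_cons.2 ⟨h, List.forall_mem_singleton.2 h'⟩) (hsubst (Prf.hyp (by simp)))
  | arr σ τ _ ih =>
    rw [hH.eqAt_arr_mem_iff] at h h' ⊢
    exact fun w => ih (h w) (h' w)

theorem eqAt_symm {t u : Tm τ} (h : eqAt τ t u ∈ H) : eqAt τ u t ∈ H :=
  hH.eqAt_right_euclidean h (hH.eqAt_refl t)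

theorem eqAt_trans {t u v : Tm τ} (h : eqAt τ t u ∈ H) (h' : eqAt τ u v ∈ H) :
    eqAt τ t v ∈ H :=
  hH.eqAt_right_euclidean (hH.eqAt_symm h) h'

include hE in
theorem eqAt_app {t u : Tm (Ty.arr σ τ)} {v w : Tm σ} (h : eqAt (Ty.arr σ τ) t u ∈ H)
    (h' : eqAt σ v w ∈ H) : eqAt τ (t.app v) (u.app w) ∈ H := by
  refine hH.eqAt_trans (hH.eqAt_arr_mem_iff.1 h v) ?_
  have hne := (Ty.ne_arr_left σ τ).symm
  have hext := hH.mem_of_mem_axioms (hE σ τ)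
  simp only [extensionality, hH.all_mem_iff, Fm.inst, Fm.subst, eqAt_subst, Tm.subst,
    hH.imp_mem_iff] at hext
  specialize hext u v w
  simp only [Sub.lift_self_zero, Sub.lift_self_succ, Sub.lift_of_ne _ _ hne, Sub.cons_self_zero,
    Tm.wk_subst_lift, Tm.wk_subst_cons, Tm.subst, Tm.subst_id] at hext
  exact hext h'

end

/-- The equality of terms up to provable extensional equality. -/
def setoid (hH : IsHenkin T H) (τ : Ty) : Setoid (Tm τ) where
  r t u := eqAt τ t u ∈ H
  iseqv := ⟨hH.eqAt_refl, hH.eqAt_symm, hH.eqAt_trans⟩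

/-- The term model: the elements are the terms up to provable extensional equality. -/
def model (hH : IsHenkin T H) (hE : ∀ ρ τ, extensionality ρ τ ∈ T) : Str where
  El τ := Quotient (hH.setoid τ)
  app {σ τ} := Quotient.map₂ Tm.app fun _ _ h _ _ h' => hH.eqAt_app hE h h'
  con c := Quotient.mk _ (Tm.con c)
  ext {σ τ f g} h := by
    induction f using Quotient.inductionOn with | _ t
    induction g using Quotient.inductionOn with | _ u
    exact Quotient.sound (hH.eqAt_arr_mem_iff.2 fun v => Quotient.exact (h (Quotient.mk _ v)))

/-- The element of the term model denoted by a term. -/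
def val (t : Tm τ) : (hH.model hE).El τ := Quotient.mk (hH.setoid τ) t

theorem val_eq_val_iff {t u : Tm τ} : hH.val hE t = hH.val hE u ↔ eqAt τ t u ∈ H := Quotient.eq

theorem val_surjective : Function.Surjective (hH.val hE (τ := τ)) := Quotient.mk_surjective

/-- The assignment in the term model given by a substitution. -/
def asg (s : Sub) : (hH.model hE).Asg := fun τ n => hH.val hE (s τ n)

theorem asg_surjective : Function.Surjective (hH.asg hE) := fun e => by
  choose s hs using fun τ n => hH.val_surjective hE (e τ n)
  exact ⟨s, funext₂ hs⟩

theorem eval_asg (s : Sub) (t : Tm τ) :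
    Str.eval (hH.asg hE s) t = hH.val hE (t.subst s) := by
  induction t with
  | var τ n => rfl
  | con c => rfl
  | app t u iht ihu => simp only [Str.eval, iht, ihu]; rfl

theorem cons_asg (s : Sub) (t : Tm τ) :
    Str.Asg.cons (hH.val hE t) (hH.asg hE s) = hH.asg hE (Sub.cons τ t s) := by
  funext ρ n
  by_cases h : ρ = τ
  · subst h
    cases n with
    | zero => rw [Str.Asg.cons_self_zero, asg, Sub.cons_self_zero]
    | succ n => rw [Str.Asg.cons_self_succ, asg, asg, Sub.cons_self_succ]
  · rw [Str.Asg.cons_of_ne _ _ _ h, asg, asg, Sub.cons_of_ne _ _ _ h]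

theorem sat_asg (s : Sub) (φ : Fm) : Str.Sat (hH.asg hE s) φ ↔ φ.subst s ∈ H := by
  induction φ generalizing s with
  | eq t u =>
    rw [Str.sat_eq, hH.eval_asg, hH.eval_asg]
    exact hH.val_eq_val_iff hE
  | bot => exact (iff_false_intro hH.bot_notMem).symm
  | imp φ ψ ihφ ihψ => rw [Str.sat_imp, ihφ, ihψ, Fm.subst, hH.imp_mem_iff]
  | all τ φ ih =>
    rw [Str.sat_all, Fm.subst, hH.all_mem_iff]
    refine (hH.val_surjective hE).forall.trans (forall_congr' fun t => ?_)
    rw [hH.cons_asg, ih, ← Fm.subst_lift_inst]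

theorem models_model (hT : SubstClosed T) : (hH.model hE).Models T := fun φ hφ e => by
  obtain ⟨s, rfl⟩ := hH.asg_surjective hE e
  exact (hH.sat_asg hE s φ).2 (hH.mem_of_mem_axioms (hT φ hφ s))

end IsHenkin

theorem proves_of_models {T : Set Fm} (hT : SubstClosed T) (hE : ∀ ρ τ, extensionality ρ τ ∈ T)
    {φ : Fm} (h : ∀ M : Str, M.Models T → ∀ e : M.Asg, Str.Sat e φ) : Proves T φ := by
  by_contra hφ
  obtain ⟨H, hH, hmem⟩ := exists_isHenkin hT (Γ := [φ.neg]) fun hbot => hφ (Prf.raa hbot)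
  have hsat := (hH.sat_asg hE Sub.id φ).1 (h _ (hH.models_model hE hT) _)
  rw [Fm.subst_id] at hsat
  exact hH.neg_mem_iff.1 (hmem _ List.mem_cons_self) hsat

namespace Str

/-! ### Models of `ACA₀^ω` -/

section

variable {M : Str}

instance : Zero (M.El Ty.nat) := ⟨M.con Con.zero⟩
instance : One (M.El Ty.nat) := ⟨M.con Con.succ (M.con Con.zero)⟩
instance : Add (M.El Ty.nat) := ⟨fun a b => M.app (M.con Con.add a) b⟩
instance : Mul (M.El Ty.nat) := ⟨fun a b => M.app (M.con Con.mul a) b⟩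

instance (τ : Ty) : Nonempty (M.El τ) := by
  induction τ with
  | nat => exact ⟨0⟩
  | arr σ τ _ ih => exact ih.map fun x => M.con (Con.pi τ σ) x

open Classical in
/-- The characteristic function of a proposition. Zero stands for truth, as in `(∃²)`. -/
noncomputable def chi (P : Prop) : M.El Ty.nat := if P then 0 else 1

end

/-- The properties of a model of `ACA₀^ω` from which everything else is derived: its arithmetic,
its combinators, induction for the zeros of its functions, the characteristic functional of
equality, and a search operator. -/
class ACA (M : Str) : Prop where
  succ_apply (n : M.El Ty.nat) : M.con Con.succ n = n + 1
  add_one_ne_zero (n : M.El Ty.nat) : n + 1 ≠ 0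
  add_one_inj (m n : M.El Ty.nat) : m + 1 = n + 1 → m = n
  add_zero (m : M.El Ty.nat) : m + 0 = m
  add_add_one (m n : M.El Ty.nat) : m + (n + 1) = m + n + 1
  mul_zero (m : M.El Ty.nat) : m * 0 = 0
  mul_add_one (m n : M.El Ty.nat) : m * (n + 1) = m * n + m
  pi {ρ σ : Ty} (x : M.El ρ) (y : M.El σ) : M.con (Con.pi ρ σ) x y = x
  sigma {ρ σ τ : Ty} (x : M.El (Ty.arr ρ (Ty.arr σ τ))) (y : M.El (Ty.arr ρ σ)) (z : M.El ρ) :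
    M.con (Con.sigma ρ σ τ) x y z = x z (y z)
  recursor_zero (f : M.El (Ty.arr Ty.nat (Ty.arr Ty.nat Ty.nat))) (m : M.El Ty.nat) :
    M.con Con.recursor f m (0 : M.El Ty.nat) = m
  recursor_add_one (f : M.El (Ty.arr Ty.nat (Ty.arr Ty.nat Ty.nat))) (m n : M.El Ty.nat) :
    M.con Con.recursor f m (n + 1) = f n (M.con Con.recursor f m n)
  induction (f : M.El Ty.one) : f (0 : M.El Ty.nat) = 0 → (∀ n, f n = 0 → f (n + 1) = 0) →
    ∀ n, f n = 0
  eq_functional : ∃ g : M.El Ty.two, ∀ x : M.El Ty.one,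
    g x = chi (x (0 : M.El Ty.nat) = x (1 : M.El Ty.nat))
  search_functional : ∃ g : M.El Ty.two, ∀ x : M.El Ty.one, (∃ n, x n = 0) → x (g x) = 0

section Axioms

variable {M : Str} (hM : M.Models ACA0ω) (e : M.Asg)

include hM

namespace Models

theorem sat {φ : Fm} (hφ : RCA0ω φ) : Sat e φ := hM φ (Or.inl hφ) e

theorem choice_functional {φ : Fm} (hφ : φ.QF)
    (h : ∀ x : M.El Ty.one, ∃ n : M.El Ty.nat, Sat (Asg.cons n (Asg.cons x e)) φ) :
    ∃ g : M.El Ty.two, ∀ x : M.El Ty.one, Sat (Asg.cons (g x) (Asg.cons x e)) φ := by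
  have hchoice := hM.sat e (RCA0ω.choice φ hφ)
  simp only [choice, sat_imp, sat_all, sat_ex, Fm.inst, Fm.wk, sat_subst] at hchoice
  obtain ⟨g, hg⟩ := hchoice h
  refine ⟨g, fun x => ?_⟩
  convert hg x using 1
  funext ρ n
  by_cases h0 : ρ = Ty.nat
  · subst h0
    cases n <;> simp [Sub.wk, Asg.cons_of_ne, eval, Sub.id]
  by_cases h1 : ρ = Ty.one
  · subst h1
    cases n <;> simp [Sub.wk, Sub.cons_of_ne, Asg.cons_of_ne, eval, Sub.id]
  by_cases h2 : ρ = Ty.two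
  · subst h2
    simp [Sub.wk, Sub.cons_of_ne, Asg.cons_of_ne, eval, Sub.id]
  · simp [Sub.wk, Sub.cons_of_ne, Asg.cons_of_ne, eval, Sub.id, h0, h1, h2]

theorem eq_functional : ∃ g : M.El Ty.two, ∀ x : M.El Ty.one,
    g x = chi (x (0 : M.El Ty.nat) = x (1 : M.El Ty.nat)) := by
  let e : M.Asg := fun _ => Classical.arbitrary _
  let valuesEq := Fm.eq ((fv 0).app zero) ((fv 0).app one)
  let φ := Fm.and (Fm.imp valuesEq (Fm.eq (nv 0) zero)) (Fm.imp valuesEq.neg (Fm.eq (nv 0) one))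
  have hφ (x : M.El Ty.one) (n : M.El Ty.nat) : Sat (Asg.cons n (Asg.cons x e)) φ ↔
      n = chi (x (0 : M.El Ty.nat) = x (1 : M.El Ty.nat)) := by
    have h : Sat (Asg.cons n (Asg.cons x e)) φ ↔
        (x (0 : M.El Ty.nat) = x (1 : M.El Ty.nat) → n = 0) ∧
          (¬ x (0 : M.El Ty.nat) = x (1 : M.El Ty.nat) → n = 1) := sat_and _ _ _
    by_cases hx : x (0 : M.El Ty.nat) = x (1 : M.El Ty.nat) <;> simp [h, hx, chi]
  obtain ⟨g, hg⟩ := hM.choice_functional e (φ := φ) (by simp [φ, valuesEq, Fm.and, Fm.neg, Fm.QF])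
    fun x => ⟨_, (hφ x _).2 rfl⟩
  exact ⟨g, fun x => (hφ x _).1 (hg x)⟩

theorem search_functional :
    ∃ g : M.El Ty.two, ∀ x : M.El Ty.one, (∃ n, x n = 0) → x (g x) = 0 := by
  let e : M.Asg := fun _ => Classical.arbitrary _
  have hexists := hM existsTwo (Or.inr rfl) e
  simp only [existsTwo, sat_all, sat_ex, sat_and, sat_iff] at hexists
  obtain ⟨E, hE⟩ := hexists
  have hE (x : M.El Ty.one) : (∃ n, x n = 0) ↔ E x = 0 := (hE x).2
  obtain ⟨g, hg⟩ := hM.choice_functional (Asg.cons E e)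
    (φ := Fm.imp (Fm.eq ((Tm.var Ty.two 0).app (fv 0)) zero) (Fm.eq ((fv 0).app (nv 0)) zero))
    ⟨trivial, trivial⟩ fun x => by
      by_cases h : ∃ n, x n = 0
      · exact h.imp fun _ hn _ => hn
      · exact ⟨0, fun h' => (h ((hE x).2 h')).elim⟩
  exact ⟨g, fun x h => hg x ((hE x).1 h)⟩

theorem succ_apply (n : M.El Ty.nat) : M.con Con.succ n = n + 1 := by
  let e : M.Asg := fun _ => Classical.arbitrary _
  have hsucc : n + 1 = M.con Con.succ (n + 0) :=
    hM.sat (Asg.cons n e) (RCA0ω.add_succ (nv 0) zero)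
  have hzero : n + 0 = n := hM.sat (Asg.cons n e) (RCA0ω.add_zero (nv 0))
  rw [hsucc, hzero]

theorem aca : M.ACA := by
  let e : M.Asg := fun _ => Classical.arbitrary _
  have hsucc := hM.succ_apply
  refine
    { succ_apply := hsucc
      add_one_ne_zero := fun n => hsucc n ▸ hM.sat (Asg.cons n e) (RCA0ω.succ_ne_zero (nv 0))
      add_one_inj := fun m n => hsucc m ▸ hsucc n ▸
        hM.sat (Asg.cons m (Asg.cons n e)) (RCA0ω.succ_inj (nv 0) (nv 1))
      add_zero := fun m => hM.sat (Asg.cons m e) (RCA0ω.add_zero (nv 0))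
      add_add_one := fun m n => hsucc n ▸ hsucc (m + n) ▸
        hM.sat (Asg.cons m (Asg.cons n e)) (RCA0ω.add_succ (nv 0) (nv 1))
      mul_zero := fun m => hM.sat (Asg.cons m e) (RCA0ω.mul_zero (nv 0))
      mul_add_one := fun m n => hsucc n ▸
        hM.sat (Asg.cons m (Asg.cons n e)) (RCA0ω.mul_succ (nv 0) (nv 1))
      pi := fun {ρ σ} x y => ?_
      sigma := fun {ρ σ τ} x y z => ?_
      recursor_zero := fun f m =>
        hM.sat (Asg.cons f (Asg.cons m e)) (RCA0ω.recur_zero (Tm.var _ 0) (nv 0))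
      recursor_add_one := fun f m n => hsucc n ▸
        hM.sat (Asg.cons f (Asg.cons m (Asg.cons n e)))
          (RCA0ω.recur_succ (Tm.var _ 0) (nv 0) (nv 1))
      induction := fun f => ?_
      eq_functional := hM.eq_functional
      search_functional := hM.search_functional }
  · have h := hM.sat (Asg.cons y (Asg.cons x e)) (RCA0ω.pi ((Tm.var ρ 0).wk σ) (Tm.var σ 0))
    simpa only [sat_eqAt, eval, eval_wk, Asg.cons_self_zero] using h
  · have h := hM.sat (Asg.cons z (Asg.cons y (Asg.cons x e)))
      (RCA0ω.sigma (((Tm.var (Ty.arr ρ (Ty.arr σ τ)) 0).wk (Ty.arr ρ σ)).wk ρ)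
        ((Tm.var (Ty.arr ρ σ) 0).wk ρ) (Tm.var ρ 0))
    simpa only [sat_eqAt, eval, eval_wk, Asg.cons_self_zero] using h
  · simp only [← hsucc]
    exact hM.sat (Asg.cons f e) (RCA0ω.induction (Fm.eq ((fv 0).app (nv 0)) zero) trivial)

end Models

end Axioms

section

variable {M : Str} (e : M.Asg)

theorem eval_zero : eval e zero = 0 := rfl

theorem eval_one : eval e one = 1 := rfl

theorem eval_add (t u : Tm Ty.nat) : eval e (add t u) = eval e t + eval e u := rfl

theorem eval_mul (t u : Tm Ty.nat) : eval e (mul t u) = eval e t * eval e u := rfl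

theorem eval_app {σ τ : Ty} (t : Tm (Ty.arr σ τ)) (u : Tm σ) :
    eval e (t.app u) = M.app (eval e t) (eval e u) := rfl

theorem eval_var (τ : Ty) (n : ℕ) : eval e (Tm.var τ n) = e τ n := rfl

theorem eval_const (σ : Ty) {ρ : Ty} (t : Tm ρ) :
    eval e (const σ t) = M.con (Con.pi ρ σ) (eval e t) := rfl

variable [M.ACA]

theorem eval_succ (t : Tm Ty.nat) : eval e (succ t) = eval e t + 1 := ACA.succ_apply _

theorem eval_two : eval e two = 1 + 1 := eval_succ e one

end

theorem ACA.zero_add_one {M : Str} [M.ACA] : (0 : M.El Ty.nat) + 1 = 1 :=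
  (ACA.succ_apply 0).symm

instance {M : Str} [M.ACA] : NeZero (1 : M.El Ty.nat) :=
  ⟨ACA.zero_add_one (M := M) ▸ ACA.add_one_ne_zero 0⟩

section

variable {M : Str} [M.ACA] {P : Prop}

theorem chi_eq_zero_iff : (chi P : M.El Ty.nat) = 0 ↔ P := by
  by_cases h : P <;> simp [chi, h]

theorem chi_eq_one_iff : (chi P : M.El Ty.nat) = 1 ↔ ¬ P := by
  by_cases h : P <;> simp [chi, h]

end

/-! ### Definable maps -/

section Represented

variable (M : Str)

/-- The values of a list of variables of the given types. -/
def Tuple : List Ty → Type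
  | [] => Unit
  | σ :: Γ => M.El σ × Tuple Γ

/-- A function of several variables is represented if it is obtained by currying from an element of
the structure. -/
def Represented : (Γ : List Ty) → {τ : Ty} → (M.Tuple Γ → M.El τ) → Prop
  | [], _, _ => True
  | σ :: Γ, τ, f => ∃ g : M.Tuple Γ → M.El (Ty.arr σ τ), Represented Γ g ∧ ∀ x e, g e x = f (x, e)

namespace Represented

variable {M} [M.ACA] {Γ : List Ty} {σ τ : Ty}

theorem const (Γ : List Ty) (c : M.El τ) : M.Represented Γ fun _ => c := by
  induction Γ generalizing τ with
  | nil => trivial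
  | cons σ Γ ih => exact ⟨_, ih (M.con (Con.pi τ σ) c), fun x _ => ACA.pi c x⟩

theorem app {f : M.Tuple Γ → M.El (Ty.arr σ τ)} {g : M.Tuple Γ → M.El σ}
    (hf : M.Represented Γ f) (hg : M.Represented Γ g) : M.Represented Γ fun e => f e (g e) := by
  induction Γ generalizing σ τ with
  | nil => trivial
  | cons ρ Γ ih =>
    obtain ⟨f', hf', hf⟩ := hf
    obtain ⟨g', hg', hg⟩ := hg
    refine ⟨_, ih (ih (const Γ (M.con (Con.sigma ρ σ τ))) hf') hg', fun x e => ?_⟩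
    rw [ACA.sigma, hf, hg]

theorem comp_snd {f : M.Tuple Γ → M.El τ} (hf : M.Represented Γ f) :
    M.Represented (σ :: Γ) fun e => f e.2 :=
  ⟨_, app (const Γ (M.con (Con.pi τ σ))) hf, fun x e => ACA.pi (f e) x⟩

theorem fst : M.Represented (σ :: Γ) Prod.fst := by
  refine ⟨_, const Γ (M.con (Con.sigma σ (Ty.arr σ σ) σ) (M.con (Con.pi σ (Ty.arr σ σ)))
    (M.con (Con.pi σ σ))), fun x e => ?_⟩
  rw [ACA.sigma, ACA.pi]

end Represented

end Represented

/-- A type together with a choice of the functions of several variables into it which are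
regarded as definable. -/
class Plots (M : Str) (A : Type) where
  plot : (Γ : List Ty) → (M.Tuple Γ → A) → Prop
  const : ∀ (Γ : List Ty) (a : A), plot Γ fun _ => a
  comp_snd : ∀ {Γ : List Ty} {p : M.Tuple Γ → A} (σ : Ty), plot Γ p → plot (σ :: Γ) fun e => p e.2

section Plots

variable {M : Str}

instance [M.ACA] (τ : Ty) : Plots M (M.El τ) where
  plot Γ p := M.Represented Γ p
  const Γ c := Represented.const Γ c
  comp_snd _ := Represented.comp_snd

instance {A B : Type} [Plots M A] [Plots M B] : Plots M (A × B) where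
  plot Γ p := Plots.plot Γ (fun e => (p e).1) ∧ Plots.plot Γ fun e => (p e).2
  const Γ c := ⟨Plots.const Γ c.1, Plots.const Γ c.2⟩
  comp_snd σ h := ⟨Plots.comp_snd σ h.1, Plots.comp_snd σ h.2⟩

instance [M.ACA] : Plots M Prop where
  plot Γ p := ∃ c : M.Tuple Γ → M.El Ty.nat, M.Represented Γ c ∧ ∀ e, p e ↔ c e = 0
  const Γ a := ⟨_, Represented.const Γ (chi a), fun _ => chi_eq_zero_iff.symm⟩
  comp_snd _ := fun ⟨_, hc, h⟩ => ⟨_, hc.comp_snd, fun e => h e.2⟩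

end Plots

/-- Definable maps, i.e. maps that preserve definable families. -/
@[fun_prop]
def Definable (M : Str) {A B : Type} [Plots M A] [Plots M B] (f : A → B) : Prop :=
  ∀ (Γ : List Ty) (p : M.Tuple Γ → A), Plots.plot Γ p → Plots.plot Γ fun e => f (p e)

namespace Definable

variable {M : Str} {A B C : Type} [Plots M A] [Plots M B] [Plots M C]

@[fun_prop]
theorem id : Definable M fun a : A => a := fun _ _ h => h

@[fun_prop]
theorem const (b : B) : Definable M fun _ : A => b := fun Γ _ _ => Plots.const Γ b

@[fun_prop]
theorem comp {f : B → C} {g : A → B} (hf : Definable M f) (hg : Definable M g) :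
    Definable M fun a => f (g a) :=
  fun Γ _ h => hf Γ _ (hg Γ _ h)

@[fun_prop]
theorem prodMk {f : A → B} {g : A → C} (hf : Definable M f) (hg : Definable M g) :
    Definable M fun a => (f a, g a) :=
  fun Γ _ h => ⟨hf Γ _ h, hg Γ _ h⟩

@[fun_prop]
theorem fst {f : A → B × C} (hf : Definable M f) : Definable M fun a => (f a).1 :=
  fun Γ _ h => (hf Γ _ h).1

@[fun_prop]
theorem snd {f : A → B × C} (hf : Definable M f) : Definable M fun a => (f a).2 :=
  fun Γ _ h => (hf Γ _ h).2

theorem of_uncurry_right {f : A → B → C} (hf : Definable M fun p : A × B => f p.1 p.2) (a : A) :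
    Definable M (f a) :=
  hf.comp (prodMk (const a) id)

@[fun_prop]
theorem app [M.ACA] {σ τ : Ty} {f : A → M.El (Ty.arr σ τ)} {g : A → M.El σ} (hf : Definable M f)
    (hg : Definable M g) : Definable M fun a => M.app (f a) (g a) :=
  fun Γ _ h => (hf Γ _ h).app (hg Γ _ h)

end Definable

section

variable {M : Str} {σ τ : Ty}

open Classical in
/-- The element of the structure that represents `f`; arbitrary if `f` is not definable. -/
noncomputable def lam (f : M.El σ → M.El τ) : M.El (Ty.arr σ τ) :=
  if h : ∃ g : M.El (Ty.arr σ τ), ∀ x, g x = f x then h.choose else Classical.arbitrary _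

theorem lam_eq {f : M.El σ → M.El τ} {g : M.El (Ty.arr σ τ)} (h : ∀ x, g x = f x) :
    lam f = g := by
  have h' : ∃ g : M.El (Ty.arr σ τ), ∀ x, g x = f x := ⟨g, h⟩
  rw [lam, dif_pos h']
  exact M.ext fun x => by rw [h'.choose_spec, h]

variable [M.ACA]

theorem lam_app {f : M.El σ → M.El τ} (hf : Definable M f) (x : M.El σ) : lam f x = f x := by
  obtain ⟨g, -, hg⟩ := hf [σ] Prod.fst Represented.fst
  rw [lam_eq fun x => hg x ()]
  exact hg x ()

variable {A : Type} [Plots M A]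

@[fun_prop]
theorem Definable.lam {f : A → M.El σ → M.El τ}
    (hf : Definable M fun p : A × M.El σ => f p.1 p.2) : Definable M fun a => lam (f a) := by
  intro Γ p hp
  obtain ⟨g, hg, h⟩ := hf (σ :: Γ) (fun e => (p e.2, e.1)) ⟨Plots.comp_snd σ hp, Represented.fst⟩
  rwa [← funext fun e => lam_eq fun x => h x e] at hg

end

section

variable {M : Str} [M.ACA]

/-- Primitive recursion; meaningful for definable `f`. -/
noncomputable def primrec (f : M.El Ty.nat → M.El Ty.nat → M.El Ty.nat) (m n : M.El Ty.nat) :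
    M.El Ty.nat := M.con Con.recursor (lam fun i => lam (f i)) m n

theorem primrec_zero (f : M.El Ty.nat → M.El Ty.nat → M.El Ty.nat) (m : M.El Ty.nat) :
    primrec f m 0 = m := ACA.recursor_zero _ _

theorem primrec_add_one {f : M.El Ty.nat → M.El Ty.nat → M.El Ty.nat}
    (hf : Definable M fun p : M.El Ty.nat × M.El Ty.nat => f p.1 p.2) (m n : M.El Ty.nat) :
    primrec f m (n + 1) = f n (primrec f m n) := by
  rw [primrec, ACA.recursor_add_one, lam_app (Definable.lam hf), lam_app (hf.of_uncurry_right n)]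
  rfl

variable {A : Type} [Plots M A]

namespace Definable

variable {f g : A → M.El Ty.nat}

@[fun_prop]
theorem add (hf : Definable M f) (hg : Definable M g) : Definable M fun a => f a + g a :=
  ((const (M.con Con.add)).app hf).app hg

@[fun_prop]
theorem mul (hf : Definable M f) (hg : Definable M g) : Definable M fun a => f a * g a :=
  ((const (M.con Con.mul)).app hf).app hg

@[fun_prop]
theorem primrec {F : A → M.El Ty.nat → M.El Ty.nat → M.El Ty.nat}
    (hF : Definable M fun p : (A × M.El Ty.nat) × M.El Ty.nat => F p.1.1 p.1.2 p.2)
    (hf : Definable M f) (hg : Definable M g) :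
    Definable M fun a => primrec (F a) (f a) (g a) :=
  (((const _).app (lam (lam hF))).app hf).app hg

theorem of_iff_eq_zero {P : A → Prop} (hf : Definable M f) (h : ∀ a, P a ↔ f a = 0) :
    Definable M P :=
  fun Γ p hp => ⟨_, hf Γ p hp, fun _ => h _⟩

theorem chi_eq (hf : Definable M f) (hg : Definable M g) :
    Definable M fun a => (chi (f a = g a) : M.El Ty.nat) := by
  obtain ⟨k, hk⟩ := ACA.eq_functional (M := M)
  -- `pair a` is a sequence that begins with `f a`, `g a`.
  let pair (a : A) : M.El Ty.one := Str.lam fun n => Str.primrec (fun _ _ => g a) (f a) n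
  have hpair : Definable M pair :=
    lam (primrec (hg.comp (by fun_prop)) (hf.comp (by fun_prop)) (by fun_prop))
  have h_zero (a : A) : pair a (0 : M.El Ty.nat) = f a := by
    rw [lam_app (by fun_prop), primrec_zero]
  have h_one (a : A) : pair a (1 : M.El Ty.nat) = g a := by
    rw [lam_app (by fun_prop), ← ACA.zero_add_one, primrec_add_one (by fun_prop)]
  simp only [← h_zero, ← h_one, ← hk]
  fun_prop

@[fun_prop]
theorem eq (hf : Definable M f) (hg : Definable M g) : Definable M fun a => f a = g a :=
  of_iff_eq_zero (chi_eq hf hg) fun _ => chi_eq_zero_iff.symm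

variable {P Q : A → Prop}

@[fun_prop]
theorem chi (hP : Definable M P) : Definable M fun a => (chi (P a) : M.El Ty.nat) := by
  intro Γ p hp
  obtain ⟨c, hc, h⟩ := hP Γ p hp
  simp only [h]
  exact chi_eq id (const 0) Γ c hc

@[fun_prop]
theorem not (hP : Definable M P) : Definable M fun a => ¬ P a := by
  simp only [← chi_eq_one_iff (M := M)]
  fun_prop

@[fun_prop]
theorem and (hP : Definable M P) (hQ : Definable M Q) : Definable M fun a => P a ∧ Q a := by
  refine of_iff_eq_zero (f := fun a => Str.chi (P a) + Str.chi (Q a)) (by fun_prop) fun a => ?_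
  by_cases hP : P a <;> by_cases hQ : Q a <;>
    simp [Str.chi, hP, hQ, ACA.add_zero, ACA.add_one_ne_zero]

@[fun_prop]
theorem or (hP : Definable M P) (hQ : Definable M Q) : Definable M fun a => P a ∨ Q a := by
  simp only [or_iff_not_and_not]
  fun_prop

theorem imp (hP : Definable M P) (hQ : Definable M Q) : Definable M fun a => P a → Q a := by
  simp only [imp_iff_not_or]
  fun_prop

@[fun_prop]
theorem ite {τ : Ty} [DecidablePred P] {f g : A → M.El τ}
    (hP : Definable M P) (hf : Definable M f) (hg : Definable M g) :
    Definable M fun a => if P a then f a else g a := by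
  induction τ generalizing A with
  | nat =>
    have h (a : A) : (if P a then f a else g a) =
        Str.primrec (fun _ _ => g a) (f a) (Str.chi (P a)) := by
      split_ifs with ha
      · rw [chi_eq_zero_iff.2 ha, primrec_zero]
      · rw [chi_eq_one_iff.2 ha, ← ACA.zero_add_one, primrec_add_one (by fun_prop)]
    simp only [h]
    fun_prop
  | arr σ τ _ ih =>
    have h (a : A) : (if P a then f a else g a) =
        Str.lam fun x => if P a then M.app (f a) x else M.app (g a) x := by
      refine (lam_eq fun x => ?_).symm
      split_ifs <;> rfl
    simp only [h]
    exact lam (ih (hP.comp (by fun_prop)) (by fun_prop) (by fun_prop))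

end Definable

/-- A definable choice of a number that satisfies `P`; meaningful for definable `P`. -/
noncomputable def search (P : M.El Ty.nat → Prop) : M.El Ty.nat :=
  (ACA.search_functional (M := M)).choose (lam fun n => chi (P n))

theorem search_spec {P : M.El Ty.nat → Prop} (hP : Definable M P) (h : ∃ n, P n) :
    P (search P) := by
  have hspec := (ACA.search_functional (M := M)).choose_spec (lam fun n => chi (P n))
  simp only [lam_app hP.chi, chi_eq_zero_iff] at hspec
  exact hspec h

section

variable {P : A → M.El Ty.nat → Prop}

@[fun_prop]
theorem Definable.search (hP : Definable M fun p : A × M.El Ty.nat => P p.1 p.2) :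
    Definable M fun a => search (P a) :=
  (Definable.const _).app (Definable.lam hP.chi)

@[fun_prop]
theorem Definable.exists (hP : Definable M fun p : A × M.El Ty.nat => P p.1 p.2) :
    Definable M fun a => ∃ n, P a n := by
  have h (a : A) : (∃ n, P a n) ↔ P a (Str.search (P a)) :=
    ⟨search_spec (hP.of_uncurry_right a), Exists.intro _⟩
  simp only [h]
  exact hP.comp (g := fun a => (a, Str.search (P a))) (by fun_prop)

theorem Definable.forall (hP : Definable M fun p : A × M.El Ty.nat => P p.1 p.2) :
    Definable M fun a => ∀ n, P a n := by
  simp only [← not_exists_not (p := P _)]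
  fun_prop

end

theorem definable_induction {P : M.El Ty.nat → Prop} (hP : Definable M P) (h_zero : P 0)
    (h_succ : ∀ n, P n → P (n + 1)) (n : M.El Ty.nat) : P n := by
  have h := ACA.induction (lam fun n => chi (P n))
  simp only [lam_app hP.chi, chi_eq_zero_iff] at h
  exact h h_zero h_succ n

end

/-! ### Arithmetic in a model -/

section Arithmetic

variable {M : Str} [M.ACA]

namespace ACA

variable (k m n : M.El Ty.nat)

theorem zero_add : 0 + m = m :=
  definable_induction (P := fun m => 0 + m = m) (by fun_prop) (add_zero _)
    (fun n h => by rw [add_add_one, h]) m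

theorem add_one_add : m + 1 + n = m + n + 1 :=
  definable_induction (P := fun n => m + 1 + n = m + n + 1) (by fun_prop)
    (by rw [add_zero, add_zero]) (fun n h => by rw [add_add_one, h, add_add_one]) n

theorem add_comm : m + n = n + m :=
  definable_induction (P := fun n => m + n = n + m) (by fun_prop)
    (by rw [add_zero, zero_add]) (fun n h => by rw [add_add_one, h, add_one_add]) n

theorem add_assoc : k + m + n = k + (m + n) :=
  definable_induction (P := fun n => k + m + n = k + (m + n)) (by fun_prop)
    (by rw [add_zero, add_zero]) (fun n h => by simp only [add_add_one, h]) n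

end ACA

instance : AddCommMonoid (M.El Ty.nat) where
  add_assoc := ACA.add_assoc
  zero_add := ACA.zero_add
  add_zero := ACA.add_zero
  add_comm := ACA.add_comm
  nsmul := nsmulRec

instance : IsRightCancelAdd (M.El Ty.nat) where
  add_right_cancel k m n h :=
    definable_induction (P := fun k => m + k = n + k → m = n)
      (Definable.imp (by fun_prop) (by fun_prop)) (by simp only [add_zero, imp_self])
      (fun k ih h => ih (ACA.add_one_inj _ _ (by rwa [add_assoc, add_assoc]))) k h

instance : IsCancelAdd (M.El Ty.nat) := AddCommMagma.IsRightCancelAdd.toIsCancelAdd _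

namespace ACA

variable (k m n : M.El Ty.nat)

theorem zero_mul : 0 * m = 0 :=
  definable_induction (P := fun m => 0 * m = 0) (by fun_prop) (mul_zero _)
    (fun n h => by rw [mul_add_one, h, add_zero]) m

theorem add_one_mul : (m + 1) * n = m * n + n :=
  definable_induction (P := fun n => (m + 1) * n = m * n + n) (by fun_prop)
    (by rw [mul_zero, mul_zero, add_zero])
    (fun n h => by rw [mul_add_one, h, mul_add_one]; ac_rfl) n

theorem mul_comm : m * n = n * m :=
  definable_induction (P := fun n => m * n = n * m) (by fun_prop)
    (by rw [mul_zero, zero_mul]) (fun n h => by rw [mul_add_one, h, add_one_mul]) n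

theorem mul_add : k * (m + n) = k * m + k * n :=
  definable_induction (P := fun n => k * (m + n) = k * m + k * n) (by fun_prop)
    (by rw [mul_zero, add_zero, add_zero])
    (fun n h => by rw [add_add_one, mul_add_one, h, mul_add_one, add_assoc]) n

theorem mul_assoc : k * m * n = k * (m * n) :=
  definable_induction (P := fun n => k * m * n = k * (m * n)) (by fun_prop)
    (by simp only [mul_zero]) (fun n h => by rw [mul_add_one, h, mul_add_one, mul_add]) n

theorem mul_one : m * 1 = m := by rw [← zero_add_one, mul_add_one, mul_zero, zero_add]

end ACA

instance : CommSemiring (M.El Ty.nat) where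
  mul_assoc := ACA.mul_assoc
  one_mul m := by rw [ACA.mul_comm, ACA.mul_one]
  mul_one := ACA.mul_one
  mul_comm := ACA.mul_comm
  zero_mul := ACA.zero_mul
  mul_zero := ACA.mul_zero
  left_distrib := ACA.mul_add
  right_distrib k m n := by rw [ACA.mul_comm, ACA.mul_add, ACA.mul_comm n k, ACA.mul_comm n m]
  nsmul := nsmulRec

theorem eq_zero_or_eq_add_one (n : M.El Ty.nat) : n = 0 ∨ ∃ m, n = m + 1 :=
  definable_induction (P := fun n => n = 0 ∨ ∃ m, n = m + 1) (by fun_prop) (Or.inl rfl)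
    (fun n _ => Or.inr ⟨n, rfl⟩) n

theorem eq_zero_of_add_eq_zero {m n : M.El Ty.nat} (h : m + n = 0) : m = 0 := by
  rcases eq_zero_or_eq_add_one m with hm | ⟨m, rfl⟩
  · exact hm
  · rw [add_right_comm] at h
    exact absurd h (ACA.add_one_ne_zero _)

theorem exists_add_eq_or (m n : M.El Ty.nat) : (∃ k, m + k = n) ∨ ∃ k, n + k = m := by
  refine definable_induction (P := fun n => (∃ k, m + k = n) ∨ ∃ k, n + k = m) (by fun_prop)
    (Or.inr ⟨m, zero_add m⟩) (fun n h => ?_) n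
  rcases h with ⟨k, rfl⟩ | ⟨k, rfl⟩
  · exact Or.inl ⟨k + 1, (add_assoc _ _ _).symm⟩
  · rcases eq_zero_or_eq_add_one k with rfl | ⟨k, rfl⟩
    · exact Or.inl ⟨1, by rw [add_zero]⟩
    · exact Or.inr ⟨k, by ring⟩

open Classical in
noncomputable instance : LinearOrder (M.El Ty.nat) where
  le m n := ∃ k, m + k = n
  le_refl n := ⟨0, add_zero n⟩
  le_trans := by
    rintro k _ _ ⟨a, rfl⟩ ⟨b, rfl⟩
    exact ⟨a + b, (add_assoc _ _ _).symm⟩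
  le_antisymm := by
    rintro m _ ⟨a, rfl⟩ ⟨b, hb⟩
    rw [add_assoc, add_eq_left] at hb
    rw [eq_zero_of_add_eq_zero hb, add_zero]
  le_total := exists_add_eq_or
  toDecidableLE := inferInstance

theorem le_iff_exists_add_eq {m n : M.El Ty.nat} : m ≤ n ↔ ∃ k, m + k = n := Iff.rfl

instance : CanonicallyOrderedAdd (M.El Ty.nat) where
  exists_add_of_le := fun ⟨k, hk⟩ => ⟨k, hk.symm⟩
  le_add_self _ n := ⟨n, add_comm _ n⟩
  le_self_add _ n := ⟨n, rfl⟩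

instance : IsOrderedCancelAddMonoid (M.El Ty.nat) where
  add_le_add_left := by
    rintro m _ ⟨a, rfl⟩ k
    exact ⟨a, by ring⟩
  le_of_add_le_add_left := by
    rintro k m n ⟨a, ha⟩
    exact ⟨a, add_left_cancel (a := k) (by rw [← ha]; ring)⟩

theorem lt_iff_exists_add_one {m n : M.El Ty.nat} : m < n ↔ ∃ k, m + k + 1 = n := by
  constructor
  · intro h
    obtain ⟨k, rfl⟩ := h.le
    rcases eq_zero_or_eq_add_one k with rfl | ⟨k, rfl⟩
    · simp only [add_zero, lt_self_iff_false] at h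
    · exact ⟨k, add_assoc _ _ _⟩
  · rintro ⟨k, rfl⟩
    refine lt_of_le_of_ne ⟨k + 1, (add_assoc _ _ _).symm⟩ fun h => ACA.add_one_ne_zero k ?_
    rwa [add_assoc, left_eq_add] at h

theorem lt_iff_add_one_le {m n : M.El Ty.nat} : m < n ↔ m + 1 ≤ n := by
  simp only [lt_iff_exists_add_one, le_iff_exists_add_eq, add_right_comm]

instance : IsStrictOrderedRing (M.El Ty.nat) :=
  have mul_lt_mul_left' (k m n : M.El Ty.nat) (hk : 0 < k) (h : m < n) : k * m < k * n := by
    obtain ⟨j, rfl⟩ := lt_iff_exists_add_one.1 h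
    obtain ⟨i, rfl⟩ := lt_iff_exists_add_one.1 hk
    exact lt_iff_exists_add_one.2 ⟨i * j + i + j, by ring⟩
  { zero_le_one := zero_le
    exists_pair_ne := ⟨0, 1, zero_ne_one⟩
    mul_lt_mul_of_pos_left := fun k hk m n h => mul_lt_mul_left' k m n hk h
    mul_lt_mul_of_pos_right := fun k hk m n h => by
      simpa only [mul_comm _ k] using mul_lt_mul_left' k m n hk h }

@[fun_prop]
theorem Definable.le {A : Type} [Plots M A] {f g : A → M.El Ty.nat} (hf : Definable M f)
    (hg : Definable M g) : Definable M fun a => f a ≤ g a := by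
  simp only [le_iff_exists_add_eq]
  fun_prop

end Arithmetic

end Str

/-! ### The ordered field of fractions of an ordered semiring -/

section Fractions

/-- The ring of differences of elements of a semiring, obtained by extension of scalars from `ℕ` to
`ℤ`. -/
def Diff (N : Type) [CommSemiring N] : Type := TensorProduct ℕ ℤ N

namespace Diff

section

variable {N : Type} [CommSemiring N]

noncomputable instance : CommRing (Diff N) := inferInstanceAs (CommRing (TensorProduct ℕ ℤ N))

/-- The canonical map from a semiring to its ring of differences. -/
noncomputable def of : N →+* Diff N :=
  (Algebra.TensorProduct.includeRight : N →ₐ[ℕ] TensorProduct ℕ ℤ N).toRingHom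

theorem of_injective [IsCancelAdd N] : Function.Injective (of (N := N)) := by
  let toGroup : TensorProduct ℕ ℤ N →ₗ[ℕ] Algebra.GrothendieckAddGroup N :=
    TensorProduct.lift (LinearMap.mk₂ ℕ
      (fun (z : ℤ) (n : N) => z • Algebra.GrothendieckAddGroup.of n)
      (fun _ _ _ => add_smul _ _ _) (fun _ _ _ => smul_assoc _ _ _)
      (fun _ _ _ => by rw [map_add, smul_add]) (fun _ _ _ => by rw [map_nsmul, smul_comm]))
  have h_of (n : N) : toGroup (of n) = Algebra.GrothendieckAddGroup.of n :=
    one_smul ℤ (Algebra.GrothendieckAddGroup.of n)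
  intro m n h
  apply Algebra.GrothendieckAddGroup.of_injective
  rw [← h_of, h, h_of]

theorem tmul_nat (k : ℕ) (n : N) : TensorProduct.tmul ℕ (k : ℤ) n = of (k • n) := by
  change _ = TensorProduct.tmul ℕ (1 : ℤ) (k • n)
  rw [← TensorProduct.smul_tmul, nsmul_one]

theorem of_sub_of [LinearOrder N] [CanonicallyOrderedAdd N] (m n : N) :
    ∃ k, of m - of n = of k ∨ of m - of n = -of k := by
  rcases le_total m n with h | h <;> obtain ⟨k, rfl⟩ := exists_add_of_le h
  · exact ⟨k, Or.inr (by rw [map_add]; ring)⟩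
  · exact ⟨k, Or.inl (by rw [map_add]; ring)⟩

theorem exists_eq_of_or_eq_neg_of [LinearOrder N] [CanonicallyOrderedAdd N] (z : Diff N) :
    ∃ n : N, z = of n ∨ z = -of n := by
  refine TensorProduct.induction_on (motive := fun z : Diff N => ∃ n : N, z = of n ∨ z = -of n) z
    ⟨0, Or.inl (map_zero _).symm⟩ (fun z n => ?_) ?_
  · obtain ⟨k, rfl | rfl⟩ := z.eq_nat_or_neg
    · exact ⟨k • n, Or.inl (tmul_nat k n)⟩
    · exact ⟨k • n, Or.inr ((TensorProduct.neg_tmul _ _).trans (congrArg Neg.neg (tmul_nat k n)))⟩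
  · rintro _ _ ⟨m, rfl | rfl⟩ ⟨n, rfl | rfl⟩
    · exact ⟨m + n, Or.inl (map_add _ _ _).symm⟩
    · exact (sub_eq_add_neg (of m) (of n)) ▸ of_sub_of m n
    · exact (neg_add_eq_sub (of m) (of n)).symm ▸ of_sub_of n m
    · exact ⟨m + n, Or.inr ((neg_add (of m) (of n)).symm.trans (congrArg _ (map_add _ _ _).symm))⟩

end

end Diff

section

variable {N : Type} [CommSemiring N]

/-- The field of fractions of an ordered semiring, in the role of the rational numbers. -/
abbrev Frac (N : Type) [CommSemiring N] : Type := FractionRing (Diff N)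

namespace Frac

/-- The canonical map from a semiring to its field of fractions. -/
noncomputable def of : N →+* Frac N := (algebraMap (Diff N) (Frac N)).comp Diff.of

variable [IsCancelAdd N]

theorem of_injective : Function.Injective (of (N := N)) :=
  (IsFractionRing.injective (Diff N) (Frac N)).comp Diff.of_injective

theorem of_eq_zero {n : N} : of n = 0 ↔ n = 0 := map_eq_zero_iff _ of_injective

end Frac

end

variable {N : Type} [CommSemiring N] [LinearOrder N] [IsStrictOrderedRing N]
  [CanonicallyOrderedAdd N]

instance : IsDomain (Diff N) :=
  have : Nontrivial (Diff N) := Diff.of_injective.nontrivial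
  have : NoZeroDivisors (Diff N) := ⟨fun {z w} h => by
    obtain ⟨m, hm⟩ := z.exists_eq_of_or_eq_neg_of
    obtain ⟨n, hn⟩ := w.exists_eq_of_or_eq_neg_of
    have h_of : Diff.of (m * n) = 0 := by
      rw [map_mul]
      rcases hm with rfl | rfl <;> rcases hn with rfl | rfl <;> simpa using h
    have h_mul : m * n = 0 := Diff.of_injective (h_of.trans (map_zero _).symm)
    rcases mul_eq_zero.1 h_mul with rfl | rfl
    · left; rcases hm with rfl | rfl <;> simp
    · right; rcases hn with rfl | rfl <;> simp⟩
  NoZeroDivisors.to_isDomain _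

namespace Frac

theorem exists_eq_div_or_eq_neg_div (x : Frac N) :
    ∃ m n : N, n ≠ 0 ∧ (x = of m / of n ∨ x = -(of m / of n)) := by
  obtain ⟨z, w, hw, rfl⟩ := IsFractionRing.div_surjective (A := Diff N) x
  obtain ⟨m, hm⟩ := z.exists_eq_of_or_eq_neg_of
  obtain ⟨n, hn⟩ := w.exists_eq_of_or_eq_neg_of
  refine ⟨m, n, ?_, ?_⟩
  · rintro rfl
    refine nonZeroDivisors.ne_zero hw ?_
    rcases hn with rfl | rfl <;> simp
  · rcases hm with rfl | rfl <;> rcases hn with rfl | rfl <;> simp [of, neg_div, div_neg]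

variable (N) in
/-- The cone of nonnegative fractions; it induces the order of the field of fractions. -/
noncomputable def cone : RingCone (Frac N) where
  carrier := {x | ∃ m n : N, n ≠ 0 ∧ x = of m / of n}
  zero_mem' := ⟨0, 1, one_ne_zero, by simp⟩
  one_mem' := ⟨1, 1, one_ne_zero, by simp⟩
  add_mem' := by
    rintro _ _ ⟨a, b, hb, rfl⟩ ⟨c, d, hd, rfl⟩
    refine ⟨a * d + b * c, b * d, mul_ne_zero hb hd, ?_⟩
    rw [div_add_div _ _ (mt of_eq_zero.1 hb) (mt of_eq_zero.1 hd)]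
    simp only [map_add, map_mul]
  mul_mem' := by
    rintro _ _ ⟨a, b, hb, rfl⟩ ⟨c, d, hd, rfl⟩
    refine ⟨a * c, b * d, mul_ne_zero hb hd, ?_⟩
    simp only [map_mul, div_mul_div_comm]
  eq_zero_of_mem_of_neg_mem' := by
    rintro _ ⟨a, b, hb, rfl⟩ ⟨c, d, hd, h⟩
    have h_of : of (a * d + c * b) = 0 := by
      rw [← neg_div, div_eq_div_iff (mt of_eq_zero.1 hb) (mt of_eq_zero.1 hd)] at h
      simp only [map_add, map_mul, ← h, neg_mul, add_neg_cancel]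
    rcases mul_eq_zero.1 (add_eq_zero.1 (of_eq_zero.1 h_of)).1 with rfl | rfl
    · rw [map_zero, zero_div]
    · exact absurd rfl hd

open Classical in
noncomputable instance : LinearOrder (Frac N) :=
  have : HasMemOrNegMem (cone N) := ⟨fun x => by
    obtain ⟨m, n, hn, rfl | rfl⟩ := exists_eq_div_or_eq_neg_div x
    · exact Or.inl ⟨m, n, hn, rfl⟩
    · exact Or.inr ⟨m, n, hn, neg_neg _⟩⟩
  LinearOrder.mkOfAddGroupCone (cone N)

instance : IsOrderedRing (Frac N) := IsOrderedRing.mkOfCone (cone N)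

instance : IsStrictOrderedRing (Frac N) := IsOrderedRing.toIsStrictOrderedRing _

theorem of_nonneg (n : N) : 0 ≤ of n := by
  change of n - 0 ∈ cone N
  exact ⟨n, 1, one_ne_zero, by simp⟩

theorem of_strictMono : StrictMono (of (N := N)) := by
  refine Monotone.strictMono_of_injective (fun m n h => ?_) of_injective
  obtain ⟨k, rfl⟩ := exists_add_of_le h
  rw [map_add]
  exact le_add_of_nonneg_right (of_nonneg k)

theorem of_le_of {m n : N} : of m ≤ of n ↔ m ≤ n := of_strictMono.le_iff_le

theorem of_lt_of {m n : N} : of m < of n ↔ m < n := of_strictMono.lt_iff_lt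

theorem of_pos {n : N} : 0 < of n ↔ 0 < n := by
  simpa only [map_zero] using of_lt_of (m := 0) (n := n)

end Frac

end Fractions

namespace Str

/-! ### Codes of rational numbers in a model -/

section Codes

variable {M : Str} [M.ACA]

/-- The number `2 ^ n` of the model. -/
noncomputable def twoPow (n : M.El Ty.nat) : M.El Ty.nat := primrec (fun _ m => 2 * m) 1 n

/-- The interpretation of `isPair`. -/
def IsPair (q a b : M.El Ty.nat) : Prop := 2 * q = (a + b) * (a + b + 1) + 2 * b

/-- The interpretation of `isRat`. -/
def IsRat (q a b c : M.El Ty.nat) : Prop := ∃ p, IsPair p a b ∧ IsPair q p c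

/-- The interpretation of `leRat`. -/
def LeRat (q q' r k : M.El Ty.nat) : Prop :=
  ∃ a b c a' b' c', IsRat q a b c ∧ IsRat q' a' b' c' ∧
    (a * (c' + 1) + b' * (c + 1)) * twoPow k ≤
      (a' * (c + 1) + b * (c' + 1)) * twoPow k + r * ((c + 1) * (c' + 1))

section Interpretation

variable (e : M.Asg)

theorem eval_pow2 (t : Tm Ty.nat) : eval e (pow2 t) = twoPow (eval e t) := by
  have h_mul : lam (fun m : M.El Ty.nat => 2 * m) = M.con Con.mul (1 + 1) :=
    lam_eq fun _ => by rw [one_add_one_eq_two]; rfl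
  have h_const : lam (fun _ : M.El Ty.nat => M.con Con.mul (1 + 1)) =
      M.con (Con.pi _ Ty.nat) (M.con Con.mul (1 + 1)) :=
    lam_eq fun i => ACA.pi _ i
  rw [twoPow, primrec, h_mul, h_const, ← eval_two e]
  rfl

theorem sat_isPair (q a b : Tm Ty.nat) :
    Sat e (isPair q a b) ↔ IsPair (eval e q) (eval e a) (eval e b) := by
  simp only [isPair, sat_eq, eval_add, eval_mul, eval_succ, eval_two, one_add_one_eq_two, IsPair]

theorem sat_isRat (q a b c : Tm Ty.nat) :
    Sat e (isRat q a b c) ↔ IsRat (eval e q) (eval e a) (eval e b) (eval e c) := by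
  simp only [isRat, sat_ex, sat_and, sat_isPair, eval_wk, eval_var, Asg.cons_self_zero, IsRat]

theorem sat_le (t u : Tm Ty.nat) : Sat e (le t u) ↔ eval e t ≤ eval e u := by
  simp only [HOA.le, sat_ex, sat_eq, eval_add, eval_wk, eval_var, Asg.cons_self_zero,
    le_iff_exists_add_eq]

theorem sat_leRat (q q' r k : Tm Ty.nat) :
    Sat e (leRat q q' r k) ↔ LeRat (eval e q) (eval e q') (eval e r) (eval e k) := by
  simp only [leRat, sat_ex, sat_and, sat_isRat, sat_le, wk6, eval_wk, eval_var, Asg.cons_self_zero,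
    Asg.cons_self_succ, LeRat, eval_add, eval_mul, eval_succ, eval_pow2]

end Interpretation

section Definability

variable {A : Type} [Plots M A] {f q q' a b c r k : A → M.El Ty.nat}

@[fun_prop]
theorem Definable.twoPow (hf : Definable M f) : Definable M fun x => twoPow (f x) := by
  unfold Str.twoPow
  fun_prop

@[fun_prop]
theorem Definable.isPair (hq : Definable M q) (ha : Definable M a) (hb : Definable M b) :
    Definable M fun x => IsPair (q x) (a x) (b x) := by
  unfold Str.IsPair
  fun_prop

@[fun_prop]
theorem Definable.isRat (hq : Definable M q) (ha : Definable M a) (hb : Definable M b)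
    (hc : Definable M c) : Definable M fun x => IsRat (q x) (a x) (b x) (c x) := by
  unfold Str.IsRat
  fun_prop

@[fun_prop]
theorem Definable.leRat (hq : Definable M q) (hq' : Definable M q') (hr : Definable M r)
    (hk : Definable M k) : Definable M fun x => LeRat (q x) (q' x) (r x) (k x) := by
  unfold Str.LeRat
  fun_prop

end Definability

theorem twoPow_zero : twoPow (0 : M.El Ty.nat) = 1 := primrec_zero _ _

theorem twoPow_add_one (n : M.El Ty.nat) : twoPow (n + 1) = 2 * twoPow n :=
  primrec_add_one (by fun_prop) _ _

theorem twoPow_add (m n : M.El Ty.nat) : twoPow (m + n) = twoPow m * twoPow n :=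
  definable_induction (P := fun n => twoPow (m + n) = twoPow m * twoPow n) (by fun_prop)
    (by rw [add_zero, twoPow_zero, mul_one])
    (fun n h => by rw [← add_assoc, twoPow_add_one, h, twoPow_add_one, mul_left_comm]) n

theorem lt_twoPow (n : M.El Ty.nat) : n < twoPow n := by
  rw [lt_iff_add_one_le]
  refine definable_induction (P := fun n => n + 1 ≤ twoPow n) (by fun_prop) ?_ (fun n h => ?_) n
  · rw [twoPow_zero, zero_add]
  · rw [twoPow_add_one, two_mul]
    exact add_le_add h (le_add_self.trans h)

theorem twoPow_pos (n : M.El Ty.nat) : 0 < twoPow n := zero_le.trans_lt (lt_twoPow n)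

theorem exists_isPair (q : M.El Ty.nat) : ∃ a b, IsPair q a b := by
  refine definable_induction (P := fun q => ∃ a b, IsPair q a b) (by fun_prop)
    ⟨0, 0, by rw [IsPair]; ring⟩ (fun q h => ?_) q
  obtain ⟨a, b, h⟩ := h
  rw [IsPair] at h
  rcases eq_zero_or_eq_add_one a with rfl | ⟨a, rfl⟩
  · refine ⟨b + 1, 0, ?_⟩
    rw [IsPair, mul_add, h]
    ring
  · refine ⟨a, b + 1, ?_⟩
    rw [IsPair, mul_add, h]
    ring

theorem exists_mul_add_one_eq_two_mul (n : M.El Ty.nat) : ∃ t, n * (n + 1) = 2 * t :=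
  definable_induction (P := fun n => ∃ t, n * (n + 1) = 2 * t) (by fun_prop)
    ⟨0, by ring⟩ (fun n ⟨t, h⟩ => ⟨t + (n + 1), by rw [mul_add 2, ← h]; ring⟩) n

theorem exists_isPair_code (a b : M.El Ty.nat) : ∃ q, IsPair q a b := by
  obtain ⟨t, ht⟩ := exists_mul_add_one_eq_two_mul (a + b)
  exact ⟨t + b, by rw [IsPair, ht, mul_add]⟩

theorem IsPair.add_le_add {q a b a' b' : M.El Ty.nat} (h : IsPair q a b) (h' : IsPair q a' b') :
    a' + b' ≤ a + b := by
  rw [IsPair] at h h'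
  by_contra hlt
  obtain ⟨k, hk⟩ := lt_iff_exists_add_one.1 (not_le.1 hlt)
  rw [← hk, h] at h'
  have hlt' : (a + b) * (a + b + 1) + 2 * b < (a + b + k + 1) * (a + b + k + 1 + 1) + 2 * b' :=
    lt_iff_exists_add_one.2 ⟨2 * a + 1 + (2 * (a + b) + 3) * k + k * k + 2 * b', by ring⟩
  exact hlt'.ne h'

theorem IsPair.unique {q a b a' b' : M.El Ty.nat} (h : IsPair q a b) (h' : IsPair q a' b') :
    a = a' ∧ b = b' := by
  have h_sum : a + b = a' + b' := le_antisymm (h'.add_le_add h) (h.add_le_add h')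
  rw [IsPair] at h h'
  rw [← h_sum, h] at h'
  obtain rfl : b = b' := mul_left_cancel₀ two_ne_zero (add_left_cancel h')
  exact ⟨add_right_cancel h_sum, rfl⟩

theorem exists_isRat (q : M.El Ty.nat) : ∃ a b c, IsRat q a b c := by
  obtain ⟨p, c, hq⟩ := exists_isPair q
  obtain ⟨a, b, hp⟩ := exists_isPair p
  exact ⟨a, b, c, p, hp, hq⟩

theorem exists_isRat_code (a b c : M.El Ty.nat) : ∃ q, IsRat q a b c := by
  obtain ⟨p, hp⟩ := exists_isPair_code a b
  obtain ⟨q, hq⟩ := exists_isPair_code p c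
  exact ⟨q, p, hp, hq⟩

theorem IsRat.unique {q a b c a' b' c' : M.El Ty.nat} (h : IsRat q a b c)
    (h' : IsRat q a' b' c') : a = a' ∧ b = b' ∧ c = c' := by
  obtain ⟨p, hp, hq⟩ := h
  obtain ⟨p', hp', hq'⟩ := h'
  obtain ⟨rfl, rfl⟩ := hq.unique hq'
  obtain ⟨rfl, rfl⟩ := hp.unique hp'
  exact ⟨rfl, rfl, rfl⟩

end Codes

section Values

variable {M : Str} [M.ACA]

open Frac (of)

theorem of_add_one_pos (n : M.El Ty.nat) : 0 < of n + 1 :=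
  add_pos_of_nonneg_of_pos (Frac.of_nonneg n) one_pos

theorem exists_eq_of_isRat (q : M.El Ty.nat) : ∃ x : Frac (M.El Ty.nat), ∀ a b c, IsRat q a b c →
    x = (of a - of b) / (of c + 1) := by
  obtain ⟨a, b, c, h⟩ := exists_isRat q
  refine ⟨(of a - of b) / (of c + 1), fun a' b' c' h' => ?_⟩
  obtain ⟨rfl, rfl, rfl⟩ := h.unique h'
  rfl

/-- The fraction coded by `q`. -/
noncomputable def val (q : M.El Ty.nat) : Frac (M.El Ty.nat) := (exists_eq_of_isRat q).choose

theorem IsRat.val_eq {q a b c : M.El Ty.nat} (h : IsRat q a b c) :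
    val q = (of a - of b) / (of c + 1) := (exists_eq_of_isRat q).choose_spec a b c h

theorem val_zero : val (0 : M.El Ty.nat) = 0 := by
  have h : IsRat (0 : M.El Ty.nat) 0 0 0 := ⟨0, by rw [IsPair]; ring, by rw [IsPair]; ring⟩
  rw [h.val_eq, sub_self, zero_div]

theorem val_one : val (1 : M.El Ty.nat) = 1 := by
  have h : IsRat (1 : M.El Ty.nat) 1 0 0 := ⟨1, by rw [IsPair]; ring, by rw [IsPair]; ring⟩
  rw [h.val_eq, map_one, map_zero, sub_zero, zero_add, div_one]

theorem val_surjective : Function.Surjective (val (M := M)) := by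
  intro x
  obtain ⟨m, n, hn, h⟩ := Frac.exists_eq_div_or_eq_neg_div x
  obtain ⟨c, rfl⟩ := (eq_zero_or_eq_add_one n).resolve_left hn
  rcases h with rfl | rfl
  · obtain ⟨q, hq⟩ := exists_isRat_code m 0 c
    exact ⟨q, by rw [hq.val_eq, map_zero, sub_zero, map_add, map_one]⟩
  · obtain ⟨q, hq⟩ := exists_isRat_code 0 m c
    exact ⟨q, by rw [hq.val_eq, map_zero, zero_sub, map_add, map_one, neg_div]⟩

/-- The fraction `2 ^ (-k)`. -/
noncomputable def halfPow (k : M.El Ty.nat) : Frac (M.El Ty.nat) := (of (twoPow k))⁻¹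

theorem of_twoPow_pos (k : M.El Ty.nat) : 0 < of (twoPow k) := Frac.of_pos.2 (twoPow_pos k)

theorem halfPow_pos (k : M.El Ty.nat) : 0 < halfPow k := inv_pos.2 (of_twoPow_pos k)

theorem halfPow_eq_two_mul (k : M.El Ty.nat) : halfPow k = 2 * halfPow (k + 1) := by
  rw [halfPow, halfPow, twoPow_add_one, map_mul, map_ofNat, mul_inv,
    mul_inv_cancel_left₀ two_ne_zero]

theorem halfPow_antitone : Antitone (halfPow (M := M)) := by
  rintro m _ ⟨k, rfl⟩
  refine inv_anti₀ (of_twoPow_pos m) (Frac.of_le_of.2 ?_)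
  rw [twoPow_add]
  exact le_mul_of_one_le_right zero_le (by simpa [lt_iff_add_one_le] using twoPow_pos k)

theorem IsRat.le_iff {q q' r k a b c a' b' c' : M.El Ty.nat} (h : IsRat q a b c)
    (h' : IsRat q' a' b' c') :
    (a * (c' + 1) + b' * (c + 1)) * twoPow k ≤
      (a' * (c + 1) + b * (c' + 1)) * twoPow k + r * ((c + 1) * (c' + 1)) ↔
      val q ≤ val q' + of r * halfPow k := by
  have hc := of_add_one_pos c
  have hc' := of_add_one_pos c'
  have hk := of_twoPow_pos k
  have h_sub : val q' + of r * halfPow k - val q =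
      ((of a' * (of c + 1) + of b * (of c' + 1)) * of (twoPow k) +
        of r * ((of c + 1) * (of c' + 1)) -
        (of a * (of c' + 1) + of b' * (of c + 1)) * of (twoPow k)) /
        ((of c + 1) * (of c' + 1) * of (twoPow k)) := by
    rw [h.val_eq, h'.val_eq, halfPow]
    field_simp
    ring
  rw [← Frac.of_le_of, ← sub_nonneg, ← sub_nonneg (a := _ + _), h_sub,
    le_div_iff₀ (by positivity), zero_mul]
  simp only [map_add, map_mul, map_one]

theorem leRat_iff {q q' r k : M.El Ty.nat} :
    LeRat q q' r k ↔ val q ≤ val q' + of r * halfPow k := by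
  constructor
  · rintro ⟨a, b, c, a', b', c', h, h', hle⟩
    exact (h.le_iff h').1 hle
  · intro hle
    obtain ⟨a, b, c, h⟩ := exists_isRat q
    obtain ⟨a', b', c', h'⟩ := exists_isRat q'
    exact ⟨a, b, c, a', b', c', h, h', (h.le_iff h').2 hle⟩

theorem exists_lt_of (x : Frac (M.El Ty.nat)) : ∃ n, x < of n := by
  obtain ⟨m, n, hn, h⟩ := Frac.exists_eq_div_or_eq_neg_div x
  obtain ⟨c, rfl⟩ := (eq_zero_or_eq_add_one n).resolve_left hn
  have h_nonneg : 0 ≤ of m / of (c + 1) := div_nonneg (Frac.of_nonneg _) (Frac.of_nonneg _)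
  have h_le : of m / of (c + 1) ≤ of m := by
    refine div_le_self (Frac.of_nonneg m) ?_
    rw [map_add, map_one]
    exact le_add_of_nonneg_left (Frac.of_nonneg c)
  refine ⟨m + 1, ?_⟩
  rw [map_add, map_one]
  rcases h with rfl | rfl <;> linarith

theorem exists_halfPow_lt {ε : Frac (M.El Ty.nat)} (hε : 0 < ε) : ∃ n, halfPow n < ε := by
  obtain ⟨n, hn⟩ := exists_lt_of ε⁻¹
  exact ⟨n, inv_lt_of_inv_lt₀ hε (hn.trans (Frac.of_lt_of.2 (lt_twoPow n)))⟩

theorem le_of_forall_le_add_halfPow {a b c : Frac (M.El Ty.nat)} (hc : 0 < c) (m : M.El Ty.nat)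
    (h : ∀ n, m ≤ n → a ≤ b + c * halfPow n) : a ≤ b := by
  by_contra hab
  obtain ⟨n, hn⟩ := exists_halfPow_lt (div_pos (sub_pos.2 (not_le.1 hab)) hc)
  have h_max := h (max m n) (le_max_left _ _)
  have h_lt := (halfPow_antitone (le_max_right m n)).trans_lt hn
  rw [lt_div_iff₀ hc] at h_lt
  linarith

end Values

/-! ### Real numbers in a model -/

section Reals

variable {M : Str} [M.ACA] {A : Type} [Plots M A] {x y : M.El Ty.one} {r s : Frac (M.El Ty.nat)}

/-- The interpretation of `isReal`. -/
def IsReal (x : M.El Ty.one) : Prop :=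
  ∀ k i : M.El Ty.nat, LeRat (x k) (x (k + i)) 1 k ∧ LeRat (x (k + i)) (x k) 1 k

/-- The interpretation of `eqReal`. -/
def EqReal (x y : M.El Ty.one) : Prop :=
  ∀ k : M.El Ty.nat, LeRat (x k) (y k) 2 k ∧ LeRat (y k) (x k) 2 k

/-- The interpretation of `leReal`. -/
def LeReal (x y : M.El Ty.one) : Prop := ∀ k : M.El Ty.nat, LeRat (x k) (y k) 2 k

/-- The fraction `r` is at most the real number `x`. -/
def Below (r : Frac (M.El Ty.nat)) (x : M.El Ty.one) : Prop :=
  ∀ k : M.El Ty.nat, r ≤ val (x k) + halfPow k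

/-- The fraction coded by `q` is at most the real number `x`; unlike `Below` this is a relation
between elements of the structure, so that it makes sense to ask whether it is definable. -/
def BelowCode (q : M.El Ty.nat) (x : M.El Ty.one) : Prop :=
  ∀ k : M.El Ty.nat, LeRat q (x k) 1 k

section Interpretation

variable (e : M.Asg) (t u : Tm Ty.one)

theorem sat_isReal : Sat e (isReal t) ↔ IsReal (eval e t) := by
  simp only [isReal, closeRat, sat_all, sat_and, sat_leRat, eval_app, eval_add, eval_wk, eval_var,
    eval_one, Asg.cons_self_zero, Asg.cons_self_succ, IsReal]

theorem sat_eqReal : Sat e (eqReal t u) ↔ EqReal (eval e t) (eval e u) := by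
  simp only [eqReal, closeRat, sat_all, sat_and, sat_leRat, eval_app, eval_wk, eval_var,
    eval_two, one_add_one_eq_two, Asg.cons_self_zero, EqReal]

theorem sat_leReal : Sat e (leReal t u) ↔ LeReal (eval e t) (eval e u) := by
  simp only [leReal, sat_all, sat_leRat, eval_app, eval_wk, eval_var, eval_two, one_add_one_eq_two,
    Asg.cons_self_zero, LeReal]

end Interpretation

section Definability

variable {f g : A → M.El Ty.one} {q : A → M.El Ty.nat}

@[fun_prop]
theorem Definable.isReal (hf : Definable M f) : Definable M fun a => IsReal (f a) := by
  unfold Str.IsReal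
  refine Definable.forall (Definable.forall ?_)
  fun_prop

@[fun_prop]
theorem Definable.eqReal (hf : Definable M f) (hg : Definable M g) :
    Definable M fun a => EqReal (f a) (g a) := by
  unfold Str.EqReal
  refine Definable.forall ?_
  fun_prop

@[fun_prop]
theorem Definable.leReal (hf : Definable M f) (hg : Definable M g) :
    Definable M fun a => LeReal (f a) (g a) := by
  unfold Str.LeReal
  refine Definable.forall ?_
  fun_prop

@[fun_prop]
theorem Definable.belowCode (hq : Definable M q) (hf : Definable M f) :
    Definable M fun a => BelowCode (q a) (f a) := by
  unfold Str.BelowCode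
  refine Definable.forall ?_
  fun_prop

end Definability

theorem isReal_iff : IsReal x ↔ ∀ k i : M.El Ty.nat,
    val (x k) ≤ val (x (k + i)) + halfPow k ∧ val (x (k + i)) ≤ val (x k) + halfPow k := by
  simp only [IsReal, leRat_iff, map_one, one_mul]

theorem eqReal_iff : EqReal x y ↔ ∀ k : M.El Ty.nat,
    val (x k) ≤ val (y k) + 2 * halfPow k ∧ val (y k) ≤ val (x k) + 2 * halfPow k := by
  simp only [EqReal, leRat_iff, map_ofNat]

theorem leReal_iff : LeReal x y ↔ ∀ k : M.El Ty.nat, val (x k) ≤ val (y k) + 2 * halfPow k := by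
  simp only [LeReal, leRat_iff, map_ofNat]

theorem belowCode_iff {q : M.El Ty.nat} : BelowCode q x ↔ Below (val q) x := by
  simp only [BelowCode, leRat_iff, map_one, one_mul, Below]

theorem Below.mono (hr : Below r x) (hs : s ≤ r) : Below s x := fun k => hs.trans (hr k)

theorem IsReal.below_sub (hx : IsReal x) (m : M.El Ty.nat) : Below (val (x m) - halfPow m) x := by
  intro k
  rw [isReal_iff] at hx
  rcases le_total m k with h | h <;> obtain ⟨i, rfl⟩ := h
  · linarith [(hx m i).1, halfPow_pos (m + i)]
  · linarith [(hx k i).2, halfPow_pos (k + i)]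

theorem EqReal.symm (h : EqReal x y) : EqReal y x := fun k => (h k).symm

theorem Below.of_eqReal (hr : Below r x) (hy : IsReal y) (h : EqReal x y) : Below r y := by
  intro k
  rw [isReal_iff] at hy
  rw [eqReal_iff] at h
  refine le_of_forall_le_add_halfPow (c := 3) (by norm_num) k fun n hn => ?_
  obtain ⟨i, rfl⟩ := hn
  linarith [hr (k + i), (h (k + i)).1, (hy k i).2]

theorem eqReal_iff_below (hx : IsReal x) (hy : IsReal y) :
    EqReal x y ↔ ∀ r, Below r x ↔ Below r y := by
  refine ⟨fun h r => ⟨fun hr => hr.of_eqReal hy h, fun hr => hr.of_eqReal hx h.symm⟩, fun h => ?_⟩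
  refine eqReal_iff.2 fun k => ⟨?_, ?_⟩
  · linarith [(h _).1 (hx.below_sub k) k]
  · linarith [(h _).2 (hy.below_sub k) k]

theorem eqReal_iff_belowCode (hx : IsReal x) (hy : IsReal y) :
    EqReal x y ↔ ∀ q : M.El Ty.nat, BelowCode q x ↔ BelowCode q y := by
  simp only [belowCode_iff, eqReal_iff_below hx hy, val_surjective.forall]

theorem EqReal.refl (hx : IsReal x) : EqReal x x := (eqReal_iff_below hx hx).2 fun _ => Iff.rfl

theorem EqReal.trans {z : M.El Ty.one} (hx : IsReal x) (hy : IsReal y) (hz : IsReal z)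
    (hxy : EqReal x y) (hyz : EqReal y z) : EqReal x z :=
  (eqReal_iff_below hx hz).2 fun r =>
    ((eqReal_iff_below hx hy).1 hxy r).trans ((eqReal_iff_below hy hz).1 hyz r)

/-- The constant sequence with value `n`. -/
def constSeq (n : M.El Ty.nat) : M.El Ty.one := M.con (Con.pi Ty.nat Ty.nat) n

theorem constSeq_apply (n k : M.El Ty.nat) : constSeq n k = n := ACA.pi n k

theorem isReal_constSeq (q : M.El Ty.nat) : IsReal (constSeq q) := by
  refine isReal_iff.2 fun k i => ?_
  rw [constSeq_apply, constSeq_apply, and_self]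
  exact le_add_of_nonneg_right (halfPow_pos k).le

theorem constSeq_leReal_iff {q : M.El Ty.nat} (hx : IsReal x) :
    LeReal (constSeq q) x ↔ Below (val q) x := by
  simp only [leReal_iff, constSeq_apply]
  refine ⟨fun h k => ?_, fun h k => by linarith [h k, halfPow_pos k]⟩
  rw [isReal_iff] at hx
  refine le_of_forall_le_add_halfPow (c := 2) (by norm_num) k fun n hn => ?_
  obtain ⟨i, rfl⟩ := hn
  linarith [h (k + i), (hx k i).2]

theorem leReal_constSeq_iff {q : M.El Ty.nat} (hx : IsReal x) :
    LeReal x (constSeq q) ↔ ∀ r, Below r x → r ≤ val q := by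
  simp only [leReal_iff, constSeq_apply]
  refine ⟨fun h r hr => ?_, fun h k => by linarith [h _ (hx.below_sub k), halfPow_pos k]⟩
  exact le_of_forall_le_add_halfPow (c := 3) (by norm_num) 0 fun n _ => by linarith [h n, hr n]

end Reals

/-! ### Represented spaces and enumeration principles -/

/-- A represented space: some sequences of numbers are regarded as names of points, and a definable
relation that is an equivalence relation on the names says when two names stand for the same
point. -/
structure RepSpace (M : Str) [M.ACA] where
  pt : M.El Ty.one → Prop
  same : M.El Ty.one → M.El Ty.one → Prop
  refl : ∀ {x}, pt x → same x x
  symm : ∀ {x y}, pt x → pt y → same x y → same y x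
  trans : ∀ {x y z}, pt x → pt y → pt z → same x y → same y z → same x z
  definable_same : Definable M fun p : M.El Ty.one × M.El Ty.one => same p.1 p.2

namespace RepSpace

variable {M : Str} [M.ACA]

section Principles

variable (X : RepSpace M)

/-- `Y` respects sameness of points. -/
def IsFun (Y : M.El Ty.two) : Prop := ∀ x y, X.pt x → X.pt y → X.same x y → Y x = Y y

/-- `A` is the characteristic function of a set of points, with value `1` for membership. -/
def IsSet (A : M.El Ty.two) : Prop := X.IsFun A ∧ ∀ x, X.pt x → A x = 0 ∨ A x = 1

/-- `Y` is injective on the set `A`. -/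
def InjOn (Y A : M.El Ty.two) : Prop :=
  ∀ x y, X.pt x → X.pt y → A x = 1 → A y = 1 → Y x = Y y → X.same x y

/-- `Y` maps the set `A` onto the numbers of the model. -/
def SurjOn (Y A : M.El Ty.two) : Prop := ∀ n, ∃ x, X.pt x ∧ A x = 1 ∧ Y x = n

/-- A sequence of points enumerates the set `A`. -/
def Enumerable (A : M.El Ty.two) : Prop :=
  ∃ s : M.El Ty.seq, (∀ n, X.pt (s n)) ∧ ∀ x, X.pt x → (A x = 1 ↔ ∃ n, X.same x (s n))

/-- The interpretation of `cocode₀`. -/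
def Cocode₀ : Prop := ∀ A, X.IsSet A → (∃ x, X.pt x ∧ A x = 1) →
  (∃ Y, X.IsFun Y ∧ X.InjOn Y A) → X.Enumerable A

/-- The interpretation of `cocode₁`. -/
def Cocode₁ : Prop := ∀ A, X.IsSet A →
  (∃ Y, X.IsFun Y ∧ X.InjOn Y A ∧ X.SurjOn Y A) → X.Enumerable A

/-- The represented space `X` interprets the space `S` of the formal language. -/
structure Interprets (S : Space) : Prop where
  sat_pt : ∀ (e : M.Asg) (t : Tm Ty.one), Sat e (S.pt t) ↔ X.pt (eval e t)
  sat_same : ∀ (e : M.Asg) (t u : Tm Ty.one), Sat e (S.same t u) ↔ X.same (eval e t) (eval e u)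

end Principles

namespace Interprets

variable {X : RepSpace M} {S : Space} (h : X.Interprets S) (e : M.Asg)

include h

theorem sat_cocode₀ : Sat e S.cocode₀ ↔ X.Cocode₀ := by
  simp only [Space.cocode₀, Space.isSet, Space.isFun, Space.nonempty, Space.countable, Space.injOn,
    Space.enumerable, Space.mem, sat_all, sat_imp, sat_and, sat_or, sat_ex, sat_iff, sat_eq,
    h.sat_pt, h.sat_same, eval_app, eval_wk, eval_var, eval_zero, eval_one, Asg.cons_self_zero,
    Asg.cons_self_succ, Cocode₀, IsSet, IsFun, InjOn, Enumerable]
  rfl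

theorem sat_cocode₁ : Sat e S.cocode₁ ↔ X.Cocode₁ := by
  simp only [Space.cocode₁, Space.isSet, Space.isFun, Space.stronglyCountable, Space.injOn,
    Space.surjOn, Space.enumerable, Space.mem, sat_all, sat_imp, sat_and, sat_or, sat_ex, sat_iff,
    sat_eq, h.sat_pt, h.sat_same, eval_app, eval_wk, eval_var, eval_zero, eval_one,
    Asg.cons_self_zero, Asg.cons_self_succ, Cocode₁, IsSet, IsFun, InjOn, SurjOn, Enumerable]
  rfl

end Interprets

@[fun_prop]
theorem definable_same_comp (X : RepSpace M) {A : Type} [Plots M A] {f g : A → M.El Ty.one}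
    (hf : Definable M f) (hg : Definable M g) : Definable M fun a => X.same (f a) (g a) :=
  X.definable_same.comp (hf.prodMk hg)

/-- `X` is a definable retract of `Z`: there are definable maps from `X` to `Z` and from `Z` to `X`
whose composite is the identity of `X`. -/
structure Retract (X Z : RepSpace M) where
  incl : M.El Ty.one → M.El Ty.one
  retr : M.El Ty.one → M.El Ty.one
  definable_incl : Definable M incl
  definable_retr : Definable M retr
  pt_incl : ∀ {x}, X.pt x → Z.pt (incl x)
  same_incl : ∀ {x y}, X.pt x → X.pt y → X.same x y → Z.same (incl x) (incl y)
  pt_retr : ∀ {z}, Z.pt z → X.pt (retr z)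
  same_retr : ∀ {z w}, Z.pt z → Z.pt w → Z.same z w → X.same (retr z) (retr w)
  retr_incl : ∀ {x}, X.pt x → X.same (retr (incl x)) x

namespace Retract

variable {X Z : RepSpace M} (R : X.Retract Z) {A Y : M.El Ty.two} {x z w : M.El Ty.one}

@[fun_prop]
theorem definable_incl_comp {A : Type} [Plots M A] {f : A → M.El Ty.one} (hf : Definable M f) :
    Definable M fun a => R.incl (f a) := R.definable_incl.comp hf

@[fun_prop]
theorem definable_retr_comp {A : Type} [Plots M A] {f : A → M.El Ty.one} (hf : Definable M f) :
    Definable M fun a => R.retr (f a) := R.definable_retr.comp hf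

theorem pt_retr_incl (hx : X.pt x) : X.pt (R.retr (R.incl x)) := R.pt_retr (R.pt_incl hx)

theorem pt_incl_retr (hz : Z.pt z) : Z.pt (R.incl (R.retr z)) := R.pt_incl (R.pt_retr hz)

theorem same_incl_retr (hz : Z.pt z) (hw : Z.pt w) (h : Z.same z w) :
    Z.same (R.incl (R.retr z)) (R.incl (R.retr w)) :=
  R.same_incl (R.pt_retr hz) (R.pt_retr hw) (R.same_retr hz hw h)

/-- `z` is, up to sameness, in the image of the inclusion. -/
def InImage (z : M.El Ty.one) : Prop := Z.same z (R.incl (R.retr z))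

theorem inImage_incl (hx : X.pt x) : R.InImage (R.incl x) :=
  R.same_incl hx (R.pt_retr_incl hx) (X.symm (R.pt_retr_incl hx) hx (R.retr_incl hx))

theorem InImage.congr (hz : Z.pt z) (hw : Z.pt w) (h : Z.same z w) (hi : R.InImage z) :
    R.InImage w :=
  Z.trans hw hz (R.pt_incl_retr hw) (Z.symm hz hw h)
    (Z.trans hz (R.pt_incl_retr hz) (R.pt_incl_retr hw) hi (R.same_incl_retr hz hw h))

/-- The functional `Y` on `X`, transferred along the retraction. -/
noncomputable def transfer (Y : M.El Ty.two) : M.El Ty.two := lam fun z => Y (R.retr z)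

open Classical in
/-- The image of the set `A` under the inclusion. -/
noncomputable def image (A : M.El Ty.two) : M.El Ty.two :=
  lam fun z => if R.InImage z then A (R.retr z) else 0

theorem transfer_apply : R.transfer Y z = Y (R.retr z) := lam_app (by fun_prop) z

open Classical in
theorem image_apply : R.image A z = if R.InImage z then A (R.retr z) else 0 := by
  refine lam_app (f := fun z => if R.InImage z then A (R.retr z) else 0) ?_ z
  unfold InImage
  fun_prop

theorem image_eq_one_iff : R.image A z = 1 ↔ R.InImage z ∧ A (R.retr z) = 1 := by
  classical
  rw [image_apply]
  split_ifs with h <;> simp [h]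

theorem isFun_transfer (hY : X.IsFun Y) : Z.IsFun (R.transfer Y) := by
  intro z w hz hw h
  rw [transfer_apply, transfer_apply]
  exact hY _ _ (R.pt_retr hz) (R.pt_retr hw) (R.same_retr hz hw h)

theorem apply_retr_incl (hY : X.IsFun Y) (hx : X.pt x) : Y (R.retr (R.incl x)) = Y x :=
  hY _ _ (R.pt_retr_incl hx) hx (R.retr_incl hx)

theorem transfer_incl (hY : X.IsFun Y) (hx : X.pt x) : R.transfer Y (R.incl x) = Y x := by
  rw [transfer_apply, R.apply_retr_incl hY hx]

theorem image_incl_eq_one_iff (hA : X.IsSet A) (hx : X.pt x) :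
    R.image A (R.incl x) = 1 ↔ A x = 1 := by
  rw [image_eq_one_iff, R.apply_retr_incl hA.1 hx, and_iff_right (R.inImage_incl hx)]

theorem isSet_image (hA : X.IsSet A) : Z.IsSet (R.image A) := by
  classical
  refine ⟨fun z w hz hw h => ?_, fun z hz => ?_⟩
  · have h_iff : R.InImage z ↔ R.InImage w := ⟨.congr R hz hw h, .congr R hw hz (Z.symm hz hw h)⟩
    rw [image_apply, image_apply, hA.1 _ _ (R.pt_retr hz) (R.pt_retr hw) (R.same_retr hz hw h)]
    simp only [h_iff]
  · rw [image_apply]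
    split_ifs
    · exact hA.2 _ (R.pt_retr hz)
    · exact Or.inl rfl

theorem injOn_transfer (hY : X.InjOn Y A) : Z.InjOn (R.transfer Y) (R.image A) := by
  intro z w hz hw hzA hwA h
  rw [image_eq_one_iff] at hzA hwA
  rw [transfer_apply, transfer_apply] at h
  have h_same := hY _ _ (R.pt_retr hz) (R.pt_retr hw) hzA.2 hwA.2 h
  have h_incl := R.same_incl (R.pt_retr hz) (R.pt_retr hw) h_same
  exact Z.trans hz (R.pt_incl_retr hz) hw hzA.1
    (Z.trans (R.pt_incl_retr hz) (R.pt_incl_retr hw) hw h_incl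
      (Z.symm hw (R.pt_incl_retr hw) hwA.1))

theorem enumerable_of_image (hA : X.IsSet A) (h : Z.Enumerable (R.image A)) : X.Enumerable A := by
  obtain ⟨s, hs, h_enum⟩ := h
  have h_mem (n : M.El Ty.nat) : A (R.retr (s n)) = 1 :=
    (R.image_eq_one_iff.1 ((h_enum _ (hs n)).2 ⟨n, Z.refl (hs n)⟩)).2
  have h_app (n : M.El Ty.nat) : lam (fun n => R.retr (s n)) n = R.retr (s n) :=
    lam_app (by fun_prop) n
  refine ⟨lam fun n => R.retr (s n), fun n => ?_, fun x hx => ?_⟩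
  · rw [h_app]
    exact R.pt_retr (hs n)
  simp only [h_app]
  constructor
  · intro hxA
    obtain ⟨n, hn⟩ := (h_enum _ (R.pt_incl hx)).1 ((R.image_incl_eq_one_iff hA hx).2 hxA)
    have hx' := R.pt_retr_incl hx
    exact ⟨n, X.trans hx hx' (R.pt_retr (hs n)) (X.symm hx' hx (R.retr_incl hx))
      (R.same_retr (R.pt_incl hx) (hs n) hn)⟩
  · rintro ⟨n, hn⟩
    rw [hA.1 _ _ hx (R.pt_retr (hs n)) hn, h_mem]

include R

theorem cocode₀ (h : Z.Cocode₀) : X.Cocode₀ := by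
  rintro A hA ⟨x, hx, hxA⟩ ⟨Y, hY, hY_inj⟩
  exact R.enumerable_of_image hA <| h (R.image A) (R.isSet_image hA)
    ⟨R.incl x, R.pt_incl hx, (R.image_incl_eq_one_iff hA hx).2 hxA⟩
    ⟨R.transfer Y, R.isFun_transfer hY, R.injOn_transfer hY_inj⟩

theorem cocode₁ (h : Z.Cocode₁) : X.Cocode₁ := by
  rintro A hA ⟨Y, hY, hY_inj, hY_surj⟩
  refine R.enumerable_of_image hA <| h (R.image A) (R.isSet_image hA)
    ⟨R.transfer Y, R.isFun_transfer hY, R.injOn_transfer hY_inj, fun n => ?_⟩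
  obtain ⟨x, hx, hxA, rfl⟩ := hY_surj n
  exact ⟨R.incl x, R.pt_incl hx, (R.image_incl_eq_one_iff hA hx).2 hxA, R.transfer_incl hY hx⟩

end Retract

end RepSpace

namespace RepSpace

variable {M : Str} [M.ACA]

/-! ### The line, the unit interval, and Cantor space -/

@[fun_prop]
theorem definable_eq_one {A : Type} [Plots M A] {f g : A → M.El Ty.one} (hf : Definable M f)
    (hg : Definable M g) : Definable M fun a => f a = g a := by
  have h (a : A) : f a = g a ↔ ∀ n, M.app (f a) n = M.app (g a) n := ⟨fun h n => by rw [h], M.ext⟩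
  simp only [h]
  refine Definable.forall ?_
  fun_prop

variable (M) in
/-- The interpretation of `realLine`. -/
def line : RepSpace M where
  pt := IsReal
  same := EqReal
  refl := EqReal.refl
  symm _ _ := EqReal.symm
  trans := EqReal.trans
  definable_same := by fun_prop

variable (M) in
/-- The interpretation of `unitInterval`. -/
def unit : RepSpace M where
  pt x := IsReal x ∧ LeReal (constSeq 0) x ∧ LeReal x (constSeq 1)
  same := EqReal
  refl hx := EqReal.refl hx.1
  symm _ _ := EqReal.symm
  trans hx hy hz := EqReal.trans hx.1 hy.1 hz.1
  definable_same := by fun_prop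

variable (M) in
/-- The interpretation of `cantorSpace`. -/
def cantor : RepSpace M where
  pt f := ∀ n : M.El Ty.nat, f n = 0 ∨ f n = 1
  same := Eq
  refl _ := rfl
  symm _ _ := Eq.symm
  trans _ _ _ := Eq.trans
  definable_same := by fun_prop

theorem line_interprets : (line M).Interprets realLine := ⟨sat_isReal, sat_eqReal⟩

theorem unit_interprets : (unit M).Interprets unitInterval := by
  refine ⟨fun e t => ?_, sat_eqReal⟩
  simp only [unitInterval, sat_and, sat_isReal, sat_leReal, eval_const, eval_zero, eval_one, unit,
    constSeq]

theorem cantor_interprets : (cantor M).Interprets cantorSpace := by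
  refine ⟨fun e t => ?_, fun e t u => sat_eqAt e t u⟩
  simp only [cantorSpace, sat_all, sat_or, sat_eq, eval_app, eval_wk, eval_var, eval_zero, eval_one,
    Asg.cons_self_zero, cantor]

theorem unit_pt_iff {x : M.El Ty.one} :
    (unit M).pt x ↔ IsReal x ∧ Below 0 x ∧ ∀ r, Below r x → r ≤ 1 := by
  refine and_congr_right fun hx => ?_
  rw [constSeq_leReal_iff hx, leReal_constSeq_iff hx, val_zero, val_one]

theorem unit_pt_congr {x y : M.El Ty.one} (hx : IsReal x) (hy : IsReal y) (h : EqReal x y) :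
    (unit M).pt x ↔ (unit M).pt y := by
  simp only [unit_pt_iff, hx, hy, (eqReal_iff_below hx hy).1 h]

theorem unit_pt_constSeq_zero : (unit M).pt (constSeq 0) := by
  have h_real := isReal_constSeq (0 : M.El Ty.nat)
  have h_refl : LeReal (constSeq (0 : M.El Ty.nat)) (constSeq 0) :=
    fun k => (EqReal.refl h_real k).1
  refine unit_pt_iff.2 ⟨h_real, ?_, fun r hr => ?_⟩
  · simpa only [val_zero] using (constSeq_leReal_iff h_real).1 h_refl
  · have h_le := (leReal_constSeq_iff h_real).1 h_refl r hr
    rw [val_zero] at h_le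
    exact h_le.trans zero_le_one

open Classical in
variable (M) in
/-- Real numbers outside the unit interval are mapped to zero. -/
noncomputable def unitRetractLine : (unit M).Retract (line M) where
  incl x := x
  retr z := if (unit M).pt z then z else constSeq 0
  definable_incl := by fun_prop
  definable_retr := by
    unfold unit
    fun_prop
  pt_incl hx := hx.1
  same_incl _ _ h := h
  pt_retr {z} _ := by
    split_ifs with h
    · exact h
    · exact unit_pt_constSeq_zero
  same_retr {z w} hz hw h := by
    rw [unit_pt_congr hz hw h]
    split_ifs
    · exact h
    · exact (unit M).refl unit_pt_constSeq_zero
  retr_incl {x} hx := by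
    rw [if_pos hx]
    exact (unit M).refl hx

/-! ### Lower cuts -/

/-- The lower cut of a real number, as a set of codes of rational numbers. -/
noncomputable def lowerCut (x : M.El Ty.one) : M.El Ty.one := lam fun q => chi (¬ BelowCode q x)

/-- The cut `c` contains the rational number with code `q`, but none that exceeds it by more than
`2 ^ (-k)`. -/
def IsApprox (c : M.El Ty.one) (k q : M.El Ty.nat) : Prop :=
  c q = (1 : M.El Ty.nat) ∧ ∀ q', ¬ LeRat q' q 1 k → c q' ≠ (1 : M.El Ty.nat)

/-- A sequence of rational approximations to the supremum of the cut `c`. -/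
noncomputable def cutReal (c : M.El Ty.one) : M.El Ty.one := lam fun k => search (IsApprox c k)

@[fun_prop]
theorem definable_lowerCut : Definable M (lowerCut (M := M)) := by
  unfold lowerCut
  fun_prop

@[fun_prop]
theorem definable_isApprox {A : Type} [Plots M A] {c : A → M.El Ty.one} {k q : A → M.El Ty.nat}
    (hc : Definable M c) (hk : Definable M k) (hq : Definable M q) :
    Definable M fun a => IsApprox (c a) (k a) (q a) := by
  unfold IsApprox
  refine Definable.and (by fun_prop) (Definable.forall (Definable.imp ?_ ?_)) <;> fun_prop

@[fun_prop]
theorem definable_cutReal {A : Type} [Plots M A] {c : A → M.El Ty.one} (hc : Definable M c) :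
    Definable M fun a => cutReal (c a) := by
  unfold cutReal
  fun_prop

theorem lowerCut_apply (x : M.El Ty.one) (q : M.El Ty.nat) :
    lowerCut x q = (chi (¬ BelowCode q x) : M.El Ty.nat) := lam_app (by fun_prop) q

theorem lowerCut_eq_one_iff {x : M.El Ty.one} {q : M.El Ty.nat} :
    lowerCut x q = (1 : M.El Ty.nat) ↔ Below (val q) x := by
  rw [lowerCut_apply, chi_eq_one_iff, not_not, belowCode_iff]

theorem cantor_pt_lowerCut (x : M.El Ty.one) : (cantor M).pt (lowerCut x) := by
  intro q
  rw [lowerCut_apply, chi_eq_zero_iff, chi_eq_one_iff]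
  exact em _

theorem isApprox_lowerCut_iff {x : M.El Ty.one} {k q : M.El Ty.nat} :
    IsApprox (lowerCut x) k q ↔
      Below (val q) x ∧ ∀ r, Below r x → r ≤ val q + halfPow k := by
  simp only [IsApprox, lowerCut_eq_one_iff, ne_eq, not_imp_not, leRat_iff, map_one, one_mul,
    val_surjective.forall]

theorem exists_isApprox_lowerCut {x : M.El Ty.one} (hx : IsReal x) (k : M.El Ty.nat) :
    ∃ q, IsApprox (lowerCut x) k q := by
  obtain ⟨q, hq⟩ := val_surjective (val (x (k + 1)) - halfPow (k + 1))
  refine ⟨q, isApprox_lowerCut_iff.2 ⟨hq ▸ hx.below_sub _, fun r hr => ?_⟩⟩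
  linarith [hr (k + 1), halfPow_eq_two_mul k]

section

variable {x : M.El Ty.one} (hx : IsReal x)

include hx

theorem isApprox_cutReal_lowerCut (k : M.El Ty.nat) :
    Below (val (cutReal (lowerCut x) k)) x ∧
      ∀ r, Below r x → r ≤ val (cutReal (lowerCut x) k) + halfPow k := by
  rw [← isApprox_lowerCut_iff, cutReal, lam_app (by fun_prop)]
  exact search_spec (by fun_prop) (exists_isApprox_lowerCut hx k)

theorem isReal_cutReal_lowerCut : IsReal (cutReal (lowerCut x)) := by
  have h := isApprox_cutReal_lowerCut hx
  refine isReal_iff.2 fun k i => ⟨?_, (h k).2 _ (h (k + i)).1⟩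
  exact ((h (k + i)).2 _ (h k).1).trans (add_le_add_right (halfPow_antitone le_self_add) _)

theorem eqReal_cutReal_lowerCut : EqReal (cutReal (lowerCut x)) x := by
  have h := isApprox_cutReal_lowerCut hx
  refine eqReal_iff.2 fun k => ⟨?_, ?_⟩
  · linarith [(h k).1 k, halfPow_pos k]
  · linarith [(h k).2 _ (hx.below_sub k)]

end

open Classical in
variable (M) in
/-- A real number is determined by its lower cut. -/
noncomputable def lineRetractCantor : (line M).Retract (cantor M) where
  incl := lowerCut
  retr c := if IsReal (cutReal c) then cutReal c else constSeq 0
  definable_incl := definable_lowerCut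
  definable_retr := by fun_prop
  pt_incl {x} _ := cantor_pt_lowerCut x
  same_incl {x y} hx hy h := M.ext fun q => by
    rw [lowerCut_apply, lowerCut_apply, (eqReal_iff_belowCode hx hy).1 h q]
  pt_retr {c} _ := by
    split_ifs with h
    · exact h
    · exact isReal_constSeq 0
  same_retr {c d} _ _ h := by
    obtain rfl : c = d := h
    refine EqReal.refl ?_
    split_ifs with h
    · exact h
    · exact isReal_constSeq 0
  retr_incl {x} hx := by
    rw [if_pos (isReal_cutReal_lowerCut hx)]
    exact eqReal_cutReal_lowerCut hx

/-! ### Expansions in base four -/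

section BaseFour

open Frac (of)

/-- The fraction `a / 4 ^ k`. -/
noncomputable def quadFrac (a k : M.El Ty.nat) : Frac (M.El Ty.nat) :=
  of a * (halfPow k * halfPow k)

theorem quadFrac_le_iff {a b k : M.El Ty.nat} : quadFrac a k ≤ quadFrac b k ↔ a ≤ b := by
  have hk := halfPow_pos k
  rw [quadFrac, quadFrac, mul_le_mul_iff_left₀ (mul_pos hk hk), Frac.of_le_of]

theorem quadFrac_mul_add (a k i : M.El Ty.nat) :
    quadFrac (a * (twoPow i * twoPow i)) (k + i) = quadFrac a k := by
  have hk := of_twoPow_pos k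
  have hi := of_twoPow_pos i
  rw [quadFrac, quadFrac, halfPow, halfPow, twoPow_add, map_mul, map_mul, map_mul]
  field_simp

theorem quadFrac_two_mul (a k : M.El Ty.nat) : quadFrac (2 * a) k = 2 * quadFrac a k := by
  rw [quadFrac, quadFrac, map_mul, map_ofNat, mul_assoc]

theorem quadFrac_two_mul_add_one_le (a k : M.El Ty.nat) :
    quadFrac (2 * a + 1) k ≤ 2 * (quadFrac a k + halfPow k) := by
  have h_le_one : halfPow k ≤ 1 := by
    simpa [halfPow, twoPow_zero] using halfPow_antitone (zero_le : 0 ≤ k)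
  have h_add : quadFrac (2 * a + 1) k = 2 * quadFrac a k + halfPow k * halfPow k := by
    rw [← quadFrac_two_mul, quadFrac, quadFrac, map_add, map_one, add_mul, one_mul]
  linarith [mul_le_mul_of_nonneg_left h_le_one (halfPow_pos k).le, halfPow_pos k]

/-- `q` codes `a / 4 ^ k`, as a quotient with denominator `c + 1`. -/
def IsQuadCode (a k q : M.El Ty.nat) : Prop := ∃ c, c + 1 = twoPow k * twoPow k ∧ IsRat q a 0 c

/-- A code of the fraction `a / 4 ^ k`. -/
noncomputable def quadCode (a k : M.El Ty.nat) : M.El Ty.nat := search (IsQuadCode a k)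

@[fun_prop]
theorem definable_isQuadCode {A : Type} [Plots M A] {a k q : A → M.El Ty.nat}
    (ha : Definable M a) (hk : Definable M k) (hq : Definable M q) :
    Definable M fun x => IsQuadCode (a x) (k x) (q x) := by
  unfold IsQuadCode
  fun_prop

@[fun_prop]
theorem definable_quadCode {A : Type} [Plots M A] {a k : A → M.El Ty.nat} (ha : Definable M a)
    (hk : Definable M k) : Definable M fun x => quadCode (a x) (k x) := by
  unfold quadCode
  fun_prop

theorem exists_isQuadCode (a k : M.El Ty.nat) : ∃ q, IsQuadCode a k q := by
  obtain ⟨c, hc⟩ := (eq_zero_or_eq_add_one (twoPow k * twoPow k)).resolve_left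
    (mul_pos (twoPow_pos k) (twoPow_pos k)).ne'
  obtain ⟨q, hq⟩ := exists_isRat_code a 0 c
  exact ⟨q, c, hc.symm, hq⟩

theorem val_quadCode (a k : M.El Ty.nat) : val (quadCode a k) = quadFrac a k := by
  obtain ⟨c, hc, h⟩ : IsQuadCode a k (quadCode a k) :=
    search_spec (by fun_prop) (exists_isQuadCode a k)
  have h_denom : of c + 1 = of (twoPow k) * of (twoPow k) := by
    rw [← map_one of, ← map_add, hc, map_mul]
  rw [h.val_eq, h_denom, map_zero, sub_zero, quadFrac, halfPow, div_eq_mul_inv, mul_inv]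

end BaseFour

section Expansion

variable {f x : M.El Ty.one}

/-- The number `∑_{i < k} 4 ^ (k - 1 - i) f(i)`. -/
noncomputable def baseFour (f : M.El Ty.one) (k : M.El Ty.nat) : M.El Ty.nat :=
  primrec (fun i m => 4 * m + f i) 0 k

/-- The real number `∑ᵢ 4 ^ (-i - 1) f(i)`, given by its partial sums. -/
noncomputable def expansion (f : M.El Ty.one) : M.El Ty.one :=
  lam fun k => quadCode (baseFour f k) k

/-- The digit of `x` with index `n` is `1`, i.e. `4 m + 1 ≤ 4 ^ (n + 1) x < 4 m + 2` for some
number `m`; meaningful for expansions with digits `0` and `1`. -/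
def IsDigit (x : M.El Ty.one) (n : M.El Ty.nat) : Prop :=
  ∃ m, BelowCode (quadCode (4 * m + 1) (n + 1)) x ∧ ¬ BelowCode (quadCode (4 * m + 2) (n + 1)) x

/-- The sequence of the digits of `x`. -/
noncomputable def digits (x : M.El Ty.one) : M.El Ty.one := lam fun n => chi (¬ IsDigit x n)

section Definability

variable {A : Type} [Plots M A] {g : A → M.El Ty.one} {n : A → M.El Ty.nat}

@[fun_prop]
theorem definable_baseFour (hg : Definable M g) (hn : Definable M n) :
    Definable M fun a => baseFour (g a) (n a) := by
  unfold baseFour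
  fun_prop

@[fun_prop]
theorem definable_isDigit (hg : Definable M g) (hn : Definable M n) :
    Definable M fun a => IsDigit (g a) (n a) := by
  unfold IsDigit
  fun_prop

theorem definable_expansion : Definable M (expansion (M := M)) := by
  unfold expansion
  fun_prop

theorem definable_digits : Definable M (digits (M := M)) := by
  unfold digits
  fun_prop

end Definability

theorem val_expansion (f : M.El Ty.one) (k : M.El Ty.nat) :
    val (expansion f k) = quadFrac (baseFour f k) k := by
  rw [expansion, lam_app (by fun_prop), val_quadCode]

theorem digits_apply (x : M.El Ty.one) (n : M.El Ty.nat) :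
    digits x n = (chi (¬ IsDigit x n) : M.El Ty.nat) := lam_app (by fun_prop) n

theorem isDigit_iff {n : M.El Ty.nat} : IsDigit x n ↔
    ∃ m, Below (quadFrac (4 * m + 1) (n + 1)) x ∧ ¬ Below (quadFrac (4 * m + 2) (n + 1)) x := by
  simp only [IsDigit, belowCode_iff, val_quadCode]

theorem cantor_pt_digits (x : M.El Ty.one) : (cantor M).pt (digits x) := by
  intro n
  rw [digits_apply, chi_eq_zero_iff, chi_eq_one_iff]
  exact em _

theorem baseFour_zero (f : M.El Ty.one) : baseFour f 0 = 0 := primrec_zero _ _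

theorem baseFour_add_one (f : M.El Ty.one) (k : M.El Ty.nat) :
    baseFour f (k + 1) = 4 * baseFour f k + f k := primrec_add_one (by fun_prop) _ _

theorem baseFour_mul_le (f : M.El Ty.one) (k i : M.El Ty.nat) :
    baseFour f k * (twoPow i * twoPow i) ≤ baseFour f (k + i) := by
  refine definable_induction
    (P := fun i => baseFour f k * (twoPow i * twoPow i) ≤ baseFour f (k + i)) (by fun_prop) ?_
    (fun i h => ?_) i
  · rw [twoPow_zero, add_zero, mul_one, mul_one]
  · rw [← add_assoc, baseFour_add_one, twoPow_add_one]
    calc baseFour f k * (2 * twoPow i * (2 * twoPow i))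
        = 4 * (baseFour f k * (twoPow i * twoPow i)) := by ring
      _ ≤ 4 * baseFour f (k + i) := mul_le_mul_right h 4
      _ ≤ 4 * baseFour f (k + i) + f (k + i) := le_self_add

section

variable (hf : (cantor M).pt f)

include hf

theorem two_mul_baseFour_add_one_le (k i : M.El Ty.nat) :
    2 * baseFour f (k + i) + 1 ≤ (2 * baseFour f k + 1) * (twoPow i * twoPow i) := by
  refine definable_induction
    (P := fun i => 2 * baseFour f (k + i) + 1 ≤ (2 * baseFour f k + 1) * (twoPow i * twoPow i))
    (by fun_prop) ?_ (fun i h => ?_) i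
  · rw [twoPow_zero, add_zero, mul_one, mul_one]
  · have h_digit : 2 * f (k + i) + 1 ≤ (4 : M.El Ty.nat) := by
      rcases hf (k + i) with h | h <;> rw [h]
      · exact ⟨3, by ring⟩
      · exact ⟨1, by ring⟩
    rw [← add_assoc, baseFour_add_one, twoPow_add_one]
    calc 2 * (4 * baseFour f (k + i) + f (k + i)) + 1
        = 4 * (2 * baseFour f (k + i)) + (2 * f (k + i) + 1) := by ring
      _ ≤ 4 * (2 * baseFour f (k + i)) + 4 := add_le_add_right h_digit _
      _ = 4 * (2 * baseFour f (k + i) + 1) := by ring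
      _ ≤ 4 * ((2 * baseFour f k + 1) * (twoPow i * twoPow i)) := mul_le_mul_right h 4
      _ = (2 * baseFour f k + 1) * (2 * twoPow i * (2 * twoPow i)) := by ring

theorem quadFrac_two_mul_baseFour_le (m n : M.El Ty.nat) :
    quadFrac (2 * baseFour f m) m ≤ quadFrac (2 * baseFour f n + 1) n := by
  rcases le_total m n with ⟨i, rfl⟩ | ⟨i, rfl⟩
  · rw [← quadFrac_mul_add _ m i, quadFrac_le_iff, mul_assoc]
    exact (mul_le_mul_right (baseFour_mul_le f m i) 2).trans le_self_add
  · rw [← quadFrac_mul_add _ n i, quadFrac_le_iff]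
    exact le_self_add.trans (two_mul_baseFour_add_one_le hf n i)

theorem below_expansion_iff {r : Frac (M.El Ty.nat)} :
    Below r (expansion f) ↔ ∀ n : M.El Ty.nat, 2 * r ≤ quadFrac (2 * baseFour f n + 1) n := by
  simp only [Below, val_expansion]
  refine ⟨fun h n => ?_, fun h k => ?_⟩
  · refine le_of_forall_le_add_halfPow two_pos 0 fun k _ => ?_
    linarith [h k, quadFrac_two_mul_baseFour_le hf k n, quadFrac_two_mul (baseFour f k) k]
  · linarith [h k, quadFrac_two_mul_add_one_le (baseFour f k) k]

theorem below_quadFrac_expansion_iff {a k : M.El Ty.nat} :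
    Below (quadFrac a k) (expansion f) ↔ a ≤ baseFour f k := by
  constructor
  · intro h
    have h_le := (below_expansion_iff hf).1 h k
    rw [← quadFrac_two_mul, quadFrac_le_iff] at h_le
    by_contra h_lt
    rw [not_le, lt_iff_add_one_le] at h_lt
    refine h_le.not_gt ?_
    calc 2 * baseFour f k + 1 < 2 * baseFour f k + 2 := by gcongr; exact one_lt_two
      _ = 2 * (baseFour f k + 1) := by ring
      _ ≤ 2 * a := mul_le_mul_right h_lt 2
  · intro h
    refine ((below_expansion_iff hf).2 fun n => ?_).mono (quadFrac_le_iff.2 h)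
    rw [← quadFrac_two_mul]
    exact quadFrac_two_mul_baseFour_le hf k n

theorem isReal_expansion : IsReal (expansion f) := by
  have h_below (m k : M.El Ty.nat) : val (expansion f m) ≤ val (expansion f k) + halfPow k := by
    rw [val_expansion f m]
    exact (below_quadFrac_expansion_iff hf).2 le_rfl k
  refine isReal_iff.2 fun k i => ⟨?_, h_below (k + i) k⟩
  linarith [h_below k (k + i), halfPow_antitone (le_self_add : k ≤ k + i)]

theorem unit_pt_expansion : (unit M).pt (expansion f) := by
  refine unit_pt_iff.2 ⟨isReal_expansion hf, ?_, fun r hr => ?_⟩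
  · have h := (below_quadFrac_expansion_iff hf (a := 0) (k := 0)).2 zero_le
    rwa [quadFrac, map_zero, zero_mul] at h
  · have h := (below_expansion_iff hf).1 hr 0
    rw [baseFour_zero, mul_zero, zero_add, quadFrac, halfPow, twoPow_zero, map_one] at h
    linarith

theorem isDigit_expansion_iff {n : M.El Ty.nat} :
    IsDigit (expansion f) n ↔ f n = (1 : M.El Ty.nat) := by
  simp only [isDigit_iff, below_quadFrac_expansion_iff hf, baseFour_add_one]
  constructor
  · rintro ⟨m, h_le, h_lt⟩
    refine (hf n).resolve_left fun h_zero => h_lt ?_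
    rw [h_zero, add_zero] at h_le ⊢
    have h_m : m + 1 ≤ baseFour f n := by
      rw [← lt_iff_add_one_le]
      by_contra h_ge
      exact ((mul_le_mul_right (not_lt.1 h_ge) 4).trans_lt (lt_add_one _)).not_ge h_le
    calc 4 * m + 2 ≤ 4 * m + 4 := add_le_add_right (show (2 : M.El Ty.nat) ≤ 4 from ⟨2, by ring⟩) _
      _ = 4 * (m + 1) := by ring
      _ ≤ 4 * baseFour f n := mul_le_mul_right h_m 4
  · intro h_one
    refine ⟨baseFour f n, ?_, ?_⟩
    · rw [h_one]
    · rw [h_one, not_le]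
      gcongr
      exact one_lt_two

theorem digits_expansion : digits (expansion f) = f := by
  refine M.ext fun n => ?_
  rw [digits_apply, isDigit_expansion_iff hf]
  rcases hf n with h | h <;> simp [h, chi]

end

end Expansion

variable (M) in
/-- A sequence of digits `0` and `1` is determined by the number with this expansion in base
four. -/
noncomputable def cantorRetractUnit : (cantor M).Retract (unit M) where
  incl := expansion
  retr := digits
  definable_incl := definable_expansion
  definable_retr := definable_digits
  pt_incl := unit_pt_expansion
  same_incl {f g} hf hg h := by
    obtain rfl : f = g := h
    exact (unit M).refl (unit_pt_expansion hf)
  pt_retr {x} _ := cantor_pt_digits x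
  same_retr {x y} hx hy h := M.ext fun n => by
    rw [digits_apply, digits_apply]
    simp only [isDigit_iff, (eqReal_iff_below hx.1 hy.1).1 h]
  retr_incl := digits_expansion

/-! ### The equivalences -/

theorem unit_cocode₀_iff_line : (unit M).Cocode₀ ↔ (line M).Cocode₀ :=
  ⟨fun h => (lineRetractCantor M).cocode₀ ((cantorRetractUnit M).cocode₀ h),
    (unitRetractLine M).cocode₀⟩

theorem line_cocode₀_iff_cantor : (line M).Cocode₀ ↔ (cantor M).Cocode₀ :=
  ⟨fun h => (cantorRetractUnit M).cocode₀ ((unitRetractLine M).cocode₀ h),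
    (lineRetractCantor M).cocode₀⟩

theorem unit_cocode₁_iff_line : (unit M).Cocode₁ ↔ (line M).Cocode₁ :=
  ⟨fun h => (lineRetractCantor M).cocode₁ ((cantorRetractUnit M).cocode₁ h),
    (unitRetractLine M).cocode₁⟩

theorem line_cocode₁_iff_cantor : (line M).Cocode₁ ↔ (cantor M).Cocode₁ :=
  ⟨fun h => (cantorRetractUnit M).cocode₁ ((unitRetractLine M).cocode₁ h),
    (lineRetractCantor M).cocode₁⟩

end RepSpace

end Str

theorem proves_ACA0ω {φ : Fm} (h : ∀ M : Str, M.ACA → ∀ e : M.Asg, Str.Sat e φ) :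
    Proves ACA0ω φ :=
  proves_of_models substClosed_ACA0ω (fun ρ τ => Or.inl (RCA0ω.extensionality ρ τ))
    fun M hM e => h M hM.aca e

end HOA

theorem mainTheorem7 :
    (HOA.Proves HOA.ACA0ω (HOA.Fm.iff HOA.unitInterval.cocode₀ HOA.realLine.cocode₀) ∧
      HOA.Proves HOA.ACA0ω (HOA.Fm.iff HOA.realLine.cocode₀ HOA.cantorSpace.cocode₀)) ∧
    (HOA.Proves HOA.ACA0ω (HOA.Fm.iff HOA.unitInterval.cocode₁ HOA.realLine.cocode₁) ∧
      HOA.Proves HOA.ACA0ω (HOA.Fm.iff HOA.realLine.cocode₁ HOA.cantorSpace.cocode₁)) := by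
  refine ⟨⟨?_, ?_⟩, ?_, ?_⟩ <;> refine HOA.proves_ACA0ω fun M hM e => ?_ <;>
    rw [HOA.Str.sat_iff]
  · rw [HOA.Str.RepSpace.unit_interprets.sat_cocode₀, HOA.Str.RepSpace.line_interprets.sat_cocode₀]
    exact HOA.Str.RepSpace.unit_cocode₀_iff_line
  · rw [HOA.Str.RepSpace.line_interprets.sat_cocode₀,
      HOA.Str.RepSpace.cantor_interprets.sat_cocode₀]
    exact HOA.Str.RepSpace.line_cocode₀_iff_cantor
  · rw [HOA.Str.RepSpace.unit_interprets.sat_cocode₁, HOA.Str.RepSpace.line_interprets.sat_cocode₁]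
    exact HOA.Str.RepSpace.unit_cocode₁_iff_line
  · rw [HOA.Str.RepSpace.line_interprets.sat_cocode₁,
      HOA.Str.RepSpace.cantor_interprets.sat_cocode₁]
    exact HOA.Str.RepSpace.line_cocode₁_iff_cantor
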